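/- Let $\mathbb{D}=\{z\in\mathbb{C}:|z|<1\}$ and let $-1\le B<A\le 1$. Let $\mathcal{C}(A,B)$ be the class of Janowski convex functions, i.e. of analytic functions $f(z)=z+\sum_{n\ge2}a_nz^n$ in $\mathbb{D}$, with $f'\neq0$ in $\mathbb{D}$, such that $$1+\frac{zf''(z)}{f'(z)}=\frac{1+A\,\omega(z)}{1+B\,\omega(z)}\qquad(z\in\mathbb{D})$$ for some analytic $\omega:\mathbb{D}\to\mathbb{D}$ with $\omega(0)=0$. The logarithmic coefficients $\gamma_n=\gamma_n(f)$ are defined by $\log\frac{f(z)}{z}=2\sum_{n\ge1}\gamma_nz^n$ near $0$, with the branch of the logarithm that vanishes at $z=0$. Put $\mu=\frac12(A-5B)$, $\nu=\frac12(3B^2-AB)$, and define the following sets of pairs $(\mu,\nu)\in\mathbb{R}^2$: \begin{align*} D_1&=\{|\mu|\le\tfrac12,\ -1<\nu\le1\},\\ D_2&=\{\tfrac12\le|\mu|\le2,\ \tfrac4{27}(|\mu|+1)^3-(|\mu|+1)\le\nu\le1\},\\ D_6&=\{2\le|\mu|\le4,\ \nu\ge\tfrac1{12}(\mu^2+8)\},\\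 D_8&=\{\tfrac12\le|\mu|\le2,\ -\tfrac23(|\mu|+1)\le\nu\le\tfrac4{27}(|\mu|+1)^3-(|\mu|+1)\},\\ D_9&=\Bigl\{|\mu|\ge2,\ -\tfrac23(|\mu|+1)\le\nu\le\tfrac{2|\mu|(|\mu|+1)}{\mu^2+2|\mu|+4}\Bigr\}. \end{align*} Then every $f\in\mathcal{C}(A,B)$ satisfies \begin{align*} |\gamma_1|&\le\frac{A-B}{4},\\ |\gamma_2|&\le\begin{cases}\dfrac{A-B}{12}&\text{if }|A-5B|\le4,\\[2mm]\dfrac{A-B}{48}|A-5B|&\text{if }|A-5B|>4,\end{cases}\\ |\gamma_3|&\le\begin{cases}\dfrac{A-B}{24}&\text{if }(\mu,\nu)\in D_1\cup D_2,\\[2mm]\dfrac{A-B}{48}|B(A-3B)|&\text{if }(\mu,\nu)\in D_6,\\[2mm]\dfrac{A-B}{72\sqrt3}\cdot\dfrac{(|A-5B|+2)^{3/2}}{\sqrt{|A-5B|+2+3B^2-AB}}&\text{if }(\mu,\nu)\in D_8\cup D_9\end{cases} \end{align*} (for $\gamma_3$ nothing is claimed when $(\mu,\nu)$ lies in none of these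 sets). All these estimates are sharp: for each admissible pair $(A,B)$ and each applicable case, equality is attained by some $f\in\mathcal{C}(A,B)$. In particular, the estimates $|\gamma_2|\le\frac{5|B|^2}{48}$ and $|\gamma_3|\le\frac{|B|^3}{16}$ do not hold for all $B\in[-0.99,0)$ and all $f\in\mathcal{C}(0,B)$: each of them fails for some such $B$ and $f$. -/

import Mathlib

namespace JanowskiConvex

noncomputable section

/-- The open unit disk in the complex plane. -/
def unitDisk : Set ℂ := Metric.ball (0 : ℂ) 1

/-- Normalized analytic functions `f(z) = z + a₂ z² + ⋯` in the unit disk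
(the values of `f` outside the disk are irrelevant). -/
def classA : Set (ℂ → ℂ) :=
  {f | AnalyticOnNhd ℂ f unitDisk ∧ f 0 = 0 ∧ deriv f 0 = 1}

/-- Subordination `f ≺ g` in the unit disk: `f = g ∘ ω` for a Schwarz function `ω`. -/
def Subordinate (f g : ℂ → ℂ) : Prop :=
  ∃ ω : ℂ → ℂ, AnalyticOnNhd ℂ ω unitDisk ∧ Set.MapsTo ω unitDisk unitDisk ∧ ω 0 = 0 ∧
    ∀ z ∈ unitDisk, f z = g (ω z)

/-- The class `C(A, B)` of Janowski convex functions. The condition `f' ≠ 0` says that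
`1 + z f'' / f'` is an analytic function in the disk. -/
def classC (A B : ℝ) : Set (ℂ → ℂ) :=
  {f | f ∈ classA ∧ (∀ z ∈ unitDisk, deriv f z ≠ 0) ∧
    Subordinate (fun z => 1 + z * deriv (deriv f) z / deriv f z)
      (fun z => (1 + (A : ℂ) * z) / (1 + (B : ℂ) * z))}

/-- The logarithmic coefficients `γₙ` of `f ∈ classA`: half the Taylor coefficients at `0` of
`log (f z / z)`. Here `dslope f 0 z` is `f z / z` for `z ≠ 0` and is `f' 0 = 1` at `z = 0`, so
that the principal logarithm is the analytic branch near `0` that vanishes at `0`. -/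
def logCoeff (f : ℂ → ℂ) (n : ℕ) : ℂ :=
  iteratedDeriv n (fun z => Complex.log (dslope f 0 z)) 0 / (n.factorial : ℂ) / 2

/-- The set of the values `|γₙ(f)|` for `f ∈ C(A, B)`. -/
def logCoeffValues (A B : ℝ) (n : ℕ) : Set ℝ :=
  {x | ∃ f ∈ classC A B, x = ‖logCoeff f n‖}

def D1 : Set (ℝ × ℝ) :=
  {p | |p.1| ≤ 1 / 2 ∧ -1 < p.2 ∧ p.2 ≤ 1}

def D2 : Set (ℝ × ℝ) :=
  {p | 1 / 2 ≤ |p.1| ∧ |p.1| ≤ 2 ∧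
    4 / 27 * (|p.1| + 1) ^ 3 - (|p.1| + 1) ≤ p.2 ∧ p.2 ≤ 1}

def D6 : Set (ℝ × ℝ) :=
  {p | 2 ≤ |p.1| ∧ |p.1| ≤ 4 ∧ 1 / 12 * (p.1 ^ 2 + 8) ≤ p.2}

def D8 : Set (ℝ × ℝ) :=
  {p | 1 / 2 ≤ |p.1| ∧ |p.1| ≤ 2 ∧ -(2 / 3) * (|p.1| + 1) ≤ p.2 ∧
    p.2 ≤ 4 / 27 * (|p.1| + 1) ^ 3 - (|p.1| + 1)}

def D9 : Set (ℝ × ℝ) :=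
  {p | 2 ≤ |p.1| ∧ -(2 / 3) * (|p.1| + 1) ≤ p.2 ∧
    p.2 ≤ 2 * |p.1| * (|p.1| + 1) / (p.1 ^ 2 + 2 * |p.1| + 4)}

/-- The point `(μ, ν) = ((A - 5B) / 2, (3B² - AB) / 2)`. -/
def paramPoint (A B : ℝ) : ℝ × ℝ :=
  ((A - 5 * B) / 2, (3 * B ^ 2 - A * B) / 2)

end

end JanowskiConvex

namespace JanowskiConvex

/-! Clearing denominators in the equation for `f` and comparing coefficients expresses the γₙ by the
Taylor coefficients cₙ of the Schwarz function ω (`logCoeff_eq`): γ₁ is (A-B)/4 times c₁, γ₂ is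
(A-B)/12 times c₂ + (μ/2) c₁², and γ₃ is (A-B)/24 times c₃ + μ c₁c₂ + ν c₁³. Conversely every ω
occurs (`exists_classC_of_schwarz`), so the problem is to find sharp bounds for these functionals on
Schwarz functions.

Two steps of the Schur algorithm parametrize c₁, c₂, c₃ (`exists_schwarz_parameters`). For the cubic
functional, a rotation and the triangle inequality give (`norm_functional_le`) the bound
(1-t²)(1-r²) + t|Z|, where t = |c₁|, |X| = r ≤ 1 and Z = νt² + (1-t²)(|μ|X - X²).

For ν > 0, |Z|² is a concave quadratic in w = Re X; its vertex yields t|Z| ≤ (νt² + (1-t²)r²)κ with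
κ² = t² + (1-t²)μ²/(4ν). If μ² ≤ 4ν, then κ ≤ 1 and the bound is max(1, ν). Otherwise the estimate
increases with r: either r = 1 suffices, or the worst X is real and negative, where r = 1 leads to
the cubic (|μ|+1)t - (|μ|+1+ν)t³, whose maximum is the bound on D8 ∪ D9. For ν ≤ 0 the constraints
on A, B force |μ| ≤ 1/2, and the triangle inequality alone gives 1.

Equality comes from ω = z, z², z³, and on D8 ∪ D9 from z(t - εz)/(1 - εtz) with t maximizing the
cubic. -/

/-! ### Inequalities in real variables -/

lemma le_of_sq_le_sq_of_nonneg {a b : ℝ} (h : a ^ 2 ≤ b ^ 2) (hb : 0 ≤ b) : a ≤ b :=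
  le_of_abs_le (abs_le_of_sq_le_sq h hb)

/-- The cubic `p t - q t³` on `t ≥ 0` is bounded by its maximum `2 p / 3 * √(p / (3 q))`. -/
lemma cubic_le {p q M t : ℝ} (hp : 0 ≤ p) (hq : 0 < q) (hM : 0 ≤ M)
    (h : 4 * p ^ 3 ≤ 27 * M ^ 2 * q) (ht : 0 ≤ t) : p * t - q * t ^ 3 ≤ M := by
  by_cases hy : p - q * t ^ 2 ≤ 0
  · nlinarith [mul_nonneg ht (neg_nonneg.2 hy)]
  · push Not at hy
    have h1 : 27 * (q * t ^ 2) * (p - q * t ^ 2) ^ 2 ≤ 4 * p ^ 3 := by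
      -- With Y = q t², this product is exactly 4p³ - 27 Y (p - Y)².
      have : 0 ≤ (4 * p - 3 * (q * t ^ 2)) * (p - 3 * (q * t ^ 2)) ^ 2 :=
        mul_nonneg (by linarith) (sq_nonneg _)
      nlinarith
    have h2 : (p * t - q * t ^ 3) ^ 2 ≤ M ^ 2 := by
      have : 27 * q * (p * t - q * t ^ 3) ^ 2 ≤ 27 * q * M ^ 2 := by nlinarith
      exact le_of_mul_le_mul_left this (by positivity)
    exact le_of_sq_le_sq_of_nonneg h2 hM

/-- The estimate at the negative real parameter `x = -r`. -/
lemma real_parameter_le {μ ν M t r : ℝ} (hμ : 0 ≤ μ) (hν : 0 < ν) (hc : 4 * ν ≤ μ ^ 2)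
    (hM : 1 ≤ M) (hG : 4 * (μ + 1) ^ 3 ≤ 27 * M ^ 2 * (μ + 1 + ν))
    (ht0 : 0 ≤ t) (ht1 : t ≤ 1) (hr1 : r ≤ 1) :
    (1 - t ^ 2) * (1 - r ^ 2) + t * ((1 - t ^ 2) * (μ * r + r ^ 2) - ν * t ^ 2) ≤ M := by
  have hcub : ∀ t, 0 ≤ t → (μ + 1) * t - (μ + 1 + ν) * t ^ 3 ≤ M := fun t ht =>
    cubic_le (by linarith) (by linarith) (by linarith) hG ht
  have hs : 0 ≤ 1 - t ^ 2 := by nlinarith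
  -- The left side is a concave quadratic in r with vertex tμ/(2(1-t)). If the vertex is at least 1,
  -- then r = 1 is worst and gives the cubic; otherwise the vertex value is used.
  by_cases hte : 2 * (1 - t) ≤ t * μ
  · have h1 := hcub t ht0
    have h2 : 0 ≤ (1 - t ^ 2) * (1 - r) * (t * μ - (1 - t) * (1 + r)) := by
      refine mul_nonneg (mul_nonneg hs (by linarith)) ?_
      nlinarith
    nlinarith
  · push Not at hte
    have h1 : (1 - t ^ 2) * (1 - r ^ 2) + t * ((1 - t ^ 2) * (μ * r + r ^ 2) - ν * t ^ 2) ≤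
        1 + t ^ 2 * ((μ ^ 2 / 4 - 1) + t * (μ ^ 2 / 4 - ν)) := by
      have : 0 ≤ (1 + t) * (t * μ - 2 * (1 - t) * r) ^ 2 :=
        mul_nonneg (by linarith) (sq_nonneg _)
      nlinarith
    refine h1.trans ?_
    -- At t = u the vertex is exactly r = 1, so there the vertex value agrees with the cubic. For t
    -- ≤ u the vertex value is at most 1 or at most its value at u.
    set u := 2 / (2 + μ) with hu
    have hu0 : 0 < u := by positivity
    have huμ : u * (2 + μ) = 2 := by rw [hu]; field_simp
    have htu : t ≤ u := by
      rw [hu, le_div_iff₀ (by linarith)]; linarith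
    have h2 : t * (μ ^ 2 / 4 - ν) ≤ u * (μ ^ 2 / 4 - ν) :=
      mul_le_mul_of_nonneg_right htu (by linarith)
    by_cases h3 : (μ ^ 2 / 4 - 1) + u * (μ ^ 2 / 4 - ν) ≤ 0
    · nlinarith [sq_nonneg t]
    · push Not at h3
      have h4 : t ^ 2 ≤ u ^ 2 := by gcongr
      have h5 : t ^ 2 * ((μ ^ 2 / 4 - 1) + t * (μ ^ 2 / 4 - ν)) ≤
          u ^ 2 * ((μ ^ 2 / 4 - 1) + u * (μ ^ 2 / 4 - ν)) :=
        (mul_le_mul_of_nonneg_left (by linarith) (sq_nonneg t)).trans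
          (mul_le_mul_of_nonneg_right h4 h3.le)
      have h6 : (μ + 1) * u - (μ + 1 + ν) * u ^ 3 =
          1 + u ^ 2 * ((μ ^ 2 / 4 - 1) + u * (μ ^ 2 / 4 - ν)) := by
        have hμu : μ * u = 2 - 2 * u := by linarith
        have e1 : μ ^ 2 * u ^ 2 = (2 - 2 * u) ^ 2 := by rw [← hμu]; ring
        linear_combination hμu * (1 - u ^ 2) - e1 * (1 + u) / 4
      linarith [hcub u hu0.le]

/-- Completing the square in `w = Re x`. -/
lemma sq_mul_sq_le {μ ν t r w N : ℝ} (hν : 0 < ν) (ht1 : t ^ 2 ≤ 1)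
    (hN : N ^ 2 = (1 - t ^ 2) ^ 2 * μ ^ 2 * r ^ 2 + (ν * t ^ 2 + (1 - t ^ 2) * r ^ 2) ^ 2 +
      2 * (1 - t ^ 2) * μ * (ν * t ^ 2 - (1 - t ^ 2) * r ^ 2) * w -
      4 * ν * t ^ 2 * (1 - t ^ 2) * w ^ 2) :
    (t * N) ^ 2 ≤ (ν * t ^ 2 + (1 - t ^ 2) * r ^ 2) ^ 2 *
      (t ^ 2 + (1 - t ^ 2) * (μ ^ 2 / (4 * ν))) := by
  have h : (ν * t ^ 2 + (1 - t ^ 2) * r ^ 2) ^ 2 *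
      (t ^ 2 + (1 - t ^ 2) * (μ ^ 2 / (4 * ν))) - t ^ 2 * N ^ 2 =
      (1 - t ^ 2) * (4 * ν * t ^ 2 * w - μ * (ν * t ^ 2 - (1 - t ^ 2) * r ^ 2)) ^ 2 /
        (4 * ν) := by
    rw [hN]; field_simp; ring
  have h2 : 0 ≤ (1 - t ^ 2) * (4 * ν * t ^ 2 * w - μ * (ν * t ^ 2 - (1 - t ^ 2) * r ^ 2)) ^ 2 /
        (4 * ν) := div_nonneg (mul_nonneg (by linarith) (sq_nonneg _)) (by linarith)
  nlinarith

/-- The hypothesis 4ν ≤ μ² is what makes κ ≥ 1, so that (1-t²)(1-r²) + (νt² + (1-t²)r²)κ is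
nondecreasing in r ≥ 0. -/
lemma exists_mul_le_mul {μ ν t r w N : ℝ} (hν : 0 < ν) (hc : 4 * ν ≤ μ ^ 2) (hT1 : t ^ 2 ≤ 1)
    (hN : N ^ 2 = (1 - t ^ 2) ^ 2 * μ ^ 2 * r ^ 2 + (ν * t ^ 2 + (1 - t ^ 2) * r ^ 2) ^ 2 +
      2 * (1 - t ^ 2) * μ * (ν * t ^ 2 - (1 - t ^ 2) * r ^ 2) * w -
      4 * ν * t ^ 2 * (1 - t ^ 2) * w ^ 2) :
    ∃ κ : ℝ, 1 ≤ κ ∧ κ ^ 2 = t ^ 2 + (1 - t ^ 2) * (μ ^ 2 / (4 * ν)) ∧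
      t * N ≤ (ν * t ^ 2 + (1 - t ^ 2) * r ^ 2) * κ := by
  have hs : 0 ≤ 1 - t ^ 2 := by linarith
  have hc1 : 1 ≤ μ ^ 2 / (4 * ν) := by rw [le_div_iff₀ (by linarith)]; linarith
  have hk1 : 1 ≤ t ^ 2 + (1 - t ^ 2) * (μ ^ 2 / (4 * ν)) := by nlinarith
  have hκ2 := Real.sq_sqrt (zero_le_one.trans hk1)
  refine ⟨_, Real.one_le_sqrt.2 hk1, hκ2, ?_⟩
  refine le_of_sq_le_sq_of_nonneg ?_ (by positivity)
  rw [mul_pow (ν * t ^ 2 + (1 - t ^ 2) * r ^ 2), hκ2]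
  exact sq_mul_sq_le hν hT1 hN

/-- `(1 + (ν - 1) T)² (T + (1 - T) c)` is decreasing in `T ≥ S` if it is at `S`. -/
lemma critical_value_antitone {ν c S T : ℝ} (hν : 0 < ν) (hc : 1 ≤ c) (hS : 0 < S) (hST : S ≤ T)
    (hT : T ≤ 1)
    (hd : ν ≤ 1 ∨ 2 * (ν - 1) * (S + (1 - S) * c) ≤ (c - 1) * (ν * S + (1 - S))) :
    (ν * T + (1 - T)) ^ 2 * (T + (1 - T) * c) ≤ (ν * S + (1 - S)) ^ 2 * (S + (1 - S) * c) := by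
  have hβ : 0 ≤ T + (1 - T) * c :=
    add_nonneg (by linarith) (mul_nonneg (by linarith) (by linarith))
  by_cases hν1 : ν ≤ 1
  · have h1 : ν * T + (1 - T) ≤ ν * S + (1 - S) := by
      have : 0 ≤ (T - S) * (1 - ν) := mul_nonneg (by linarith) (by linarith)
      linarith
    have h2 : T + (1 - T) * c ≤ S + (1 - S) * c := by
      have : 0 ≤ (T - S) * (c - 1) := mul_nonneg (by linarith) (by linarith)
      linarith
    have h3 : 0 ≤ ν * T + (1 - T) :=
      add_nonneg (mul_nonneg hν.le (by linarith)) (by linarith)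
    exact mul_le_mul (pow_le_pow_left₀ h3 h1 2) h2 hβ (sq_nonneg _)
  · push Not at hν1
    have key := hd.resolve_left (not_le.2 hν1)
    have hα0 : 0 ≤ ν * S + (1 - S) :=
      add_nonneg (mul_nonneg hν.le hS.le) (by linarith)
    obtain ⟨δ, rfl⟩ : ∃ δ, T = S + δ := ⟨T - S, by ring⟩
    obtain ⟨d, rfl⟩ : ∃ d, ν = 1 + d := ⟨ν - 1, by ring⟩
    obtain ⟨e, rfl⟩ : ∃ e, c = 1 + e := ⟨c - 1, by ring⟩
    have e1 : (1 + d) * (S + δ) + (1 - (S + δ)) = ((1 + d) * S + (1 - S)) + d * δ := by ring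
    have e2 : S + δ + (1 - (S + δ)) * (1 + e) = (S + (1 - S) * (1 + e)) - e * δ := by ring
    rw [e1, e2]
    -- Now (α + dδ)²(β - eδ) ≤ α²β is to be shown; `key'` says that the derivative in δ at δ = 0 is
    -- nonpositive, and the difference is a combination of the four products below.
    generalize (1 + d) * S + (1 - S) = α at *
    generalize S + (1 - S) * (1 + e) = β at *
    have hδ0 : 0 ≤ δ := by linarith
    have hd0 : 0 ≤ d := by linarith
    have he0 : 0 ≤ e := by linarith
    have key' : 0 ≤ e * α - 2 * d * β := by linarith
    have h1 : 0 ≤ δ * α * (e * α - 2 * d * β) := by positivity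
    have h2 : 0 ≤ δ ^ 2 * d * (e * α - 2 * d * β) := by positivity
    have h3 : 0 ≤ δ ^ 2 * d * (e * α) := by positivity
    have h4 : 0 ≤ δ ^ 3 * e * d ^ 2 := by positivity
    linarith

/-- The value at the critical phase, for `t` beyond the threshold at which it becomes real. -/
lemma critical_phase_le {μ ν M T : ℝ} (hμ : 0 < μ) (hν : 0 < ν) (hc : 4 * ν ≤ μ ^ 2)
    (hG : 4 * (μ + 1) ^ 3 ≤ 27 * M ^ 2 * (μ + 1 + ν))
    (hd : ν ≤ 1 ∨ ν * (μ ^ 2 + 2 * μ + 4) ≤ 2 * μ * (μ + 1)) (hT1 : T ≤ 1)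
    (hT : μ ≤ T * (4 * ν + μ + μ * ν)) :
    (ν * T + (1 - T)) ^ 2 * (T + (1 - T) * (μ ^ 2 / (4 * ν))) ≤ M ^ 2 := by
  -- At t² = S and r = 1 the vertex in w is exactly -1, so the critical value is the square of the
  -- cubic at √S.
  set S := μ / (4 * ν + μ + μ * ν) with hS
  have hden : 0 < 4 * ν + μ + μ * ν := by positivity
  have hSden : S * (4 * ν + μ + μ * ν) = μ := by rw [hS]; field_simp
  have hS0 : 0 < S := by positivity
  have hST : S ≤ T := by rw [hS, div_le_iff₀ hden]; exact hT
  set c := μ ^ 2 / (4 * ν) with hcdef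
  have hcν : c * (4 * ν) = μ ^ 2 := by rw [hcdef]; field_simp
  have hc1 : 1 ≤ c := by rw [hcdef, le_div_iff₀ (by linarith)]; linarith
  have hSval : (ν * S + (1 - S)) ^ 2 * (S + (1 - S) * c) =
      S * ((μ + 1) - (μ + 1 + ν) * S) ^ 2 := by
    rw [hcdef, hS]; field_simp; ring
  have hSle : S * ((μ + 1) - (μ + 1 + ν) * S) ^ 2 ≤ M ^ 2 := by
    have hq : 0 < μ + 1 + ν := by linarith
    have h0 : (μ + 1 + ν) * S ≤ μ + 1 := by
      rw [hS, mul_div_assoc', div_le_iff₀ hden]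
      nlinarith [mul_pos hμ hν, mul_pos (mul_pos hμ hν) hμ]
    have h1 : 0 ≤ (4 * (μ + 1) - 3 * ((μ + 1 + ν) * S)) *
        ((μ + 1) - 3 * ((μ + 1 + ν) * S)) ^ 2 := mul_nonneg (by linarith) (sq_nonneg _)
    have h2 : 27 * (μ + 1 + ν) * (S * ((μ + 1) - (μ + 1 + ν) * S) ^ 2) ≤
        27 * (μ + 1 + ν) * M ^ 2 := by nlinarith
    exact le_of_mul_le_mul_left h2 (by positivity)
  refine le_trans ?_ (hSval.trans_le hSle)
  refine critical_value_antitone hν hc1 hS0 hST hT1 (hd.imp_right fun hd => ?_)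
  -- The derivative condition at S is, up to a positive factor, the upper bound on ν that defines
  -- `D9`.
  have h1 : (c - 1) * (ν * S + (1 - S)) - 2 * (ν - 1) * (S + (1 - S) * c) =
      (2 * μ * (μ + 1) - ν * (μ ^ 2 + 2 * μ + 4)) * (μ + 2) /
        (2 * (4 * ν + μ + μ * ν)) := by
    rw [hcdef, hS]; field_simp; ring
  have h2 : 0 ≤ (2 * μ * (μ + 1) - ν * (μ ^ 2 + 2 * μ + 4)) * (μ + 2) /
        (2 * (4 * ν + μ + μ * ν)) :=
    div_nonneg (mul_nonneg (by linarith) (by linarith)) (by positivity)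
  linarith

/-- The vertex in w lies at or left of -r exactly when g(r) = μ((1-t²)r² - νt²) - 4νt²r ≥ 0 (for t >
0). If g(1) ≤ 0, the vertex bound is pushed to r = 1. If g(1) > 0 and g(r) ≥ 0, the maximum over w ≥
-r is at X = -r. In the remaining case the vertex bound is pushed to a zero ρ of g, where it equals
the value at X = -ρ. Hypothesis `hG` says that M bounds the cubic. -/
lemma le_of_four_mul_le_sq {μ ν M t r w N : ℝ} (hμ : 0 ≤ μ) (hν : 0 < ν) (hc : 4 * ν ≤ μ ^ 2)
    (hM : 1 ≤ M) (hG : 4 * (μ + 1) ^ 3 ≤ 27 * M ^ 2 * (μ + 1 + ν))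
    (hd : ν ≤ 1 ∨ ν * (μ ^ 2 + 2 * μ + 4) ≤ 2 * μ * (μ + 1))
    (ht0 : 0 ≤ t) (ht1 : t ≤ 1) (hr0 : 0 ≤ r) (hr1 : r ≤ 1) (hw : -r ≤ w)
    (hN : N ^ 2 = (1 - t ^ 2) ^ 2 * μ ^ 2 * r ^ 2 + (ν * t ^ 2 + (1 - t ^ 2) * r ^ 2) ^ 2 +
      2 * (1 - t ^ 2) * μ * (ν * t ^ 2 - (1 - t ^ 2) * r ^ 2) * w -
      4 * ν * t ^ 2 * (1 - t ^ 2) * w ^ 2) :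
    (1 - t ^ 2) * (1 - r ^ 2) + t * N ≤ M := by
  have hT1 : t ^ 2 ≤ 1 := by nlinarith
  have hs : 0 ≤ 1 - t ^ 2 := by linarith
  have hμ0 : 0 < μ := by
    rcases hμ.eq_or_lt with h | h
    · rw [← h] at hc; linarith
    · exact h
  have hc1 : 1 ≤ μ ^ 2 / (4 * ν) := by rw [le_div_iff₀ (by linarith)]; linarith
  obtain ⟨κ, hκ1, hκ2, htN⟩ := exists_mul_le_mul hν hc hT1 hN
  have hlin : ∀ ρ, r ≤ ρ → (1 - t ^ 2) * (1 - r ^ 2) + t * N ≤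
      (1 - t ^ 2) * (1 - ρ ^ 2) + (ν * t ^ 2 + (1 - t ^ 2) * ρ ^ 2) * κ := by
    intro ρ hρ
    have h1 : r ^ 2 ≤ ρ ^ 2 := by gcongr
    have h2 : 0 ≤ (1 - t ^ 2) * ((ρ ^ 2 - r ^ 2) * (κ - 1)) :=
      mul_nonneg hs (mul_nonneg (by linarith) (by linarith))
    nlinarith
  by_cases hT : μ ≤ t ^ 2 * (4 * ν + μ + μ * ν)
  · refine (hlin 1 hr1).trans ?_
    have h1 := critical_phase_le hμ0 hν hc hG hd hT1 hT
    have h2 : (ν * t ^ 2 + (1 - t ^ 2)) * κ ≤ M := by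
      refine le_of_sq_le_sq_of_nonneg ?_ (by linarith)
      rw [mul_pow, hκ2]; exact h1
    linarith
  · push Not at hT
    by_cases hg : 0 ≤ μ * ((1 - t ^ 2) * r ^ 2 - ν * t ^ 2) - 4 * ν * t ^ 2 * r
    · have hle : N ^ 2 ≤ ((1 - t ^ 2) * (μ * r + r ^ 2) - ν * t ^ 2) ^ 2 := by
        have : ((1 - t ^ 2) * (μ * r + r ^ 2) - ν * t ^ 2) ^ 2 - N ^ 2 =
            (1 - t ^ 2) * (w + r) * (4 * ν * t ^ 2 * (w + r) +
              2 * (μ * ((1 - t ^ 2) * r ^ 2 - ν * t ^ 2) - 4 * ν * t ^ 2 * r)) := by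
          rw [hN]; ring
        have : 0 ≤ (1 - t ^ 2) * (w + r) * (4 * ν * t ^ 2 * (w + r) +
              2 * (μ * ((1 - t ^ 2) * r ^ 2 - ν * t ^ 2) - 4 * ν * t ^ 2 * r)) := by
          have hwr : 0 ≤ w + r := by linarith
          exact mul_nonneg (mul_nonneg hs hwr)
            (add_nonneg (mul_nonneg (by positivity) hwr) (by linarith))
        linarith
      have h0 : 0 ≤ (1 - t ^ 2) * r ^ 2 - ν * t ^ 2 := by
        have : 0 ≤ 4 * ν * t ^ 2 * r := by positivity
        exact nonneg_of_mul_nonneg_right (by linarith) hμ0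
      have h00 : 0 ≤ (1 - t ^ 2) * (μ * r + r ^ 2) - ν * t ^ 2 := by
        have : 0 ≤ (1 - t ^ 2) * (μ * r) := by positivity
        linarith
      have hle' := le_of_sq_le_sq_of_nonneg hle h00
      have := real_parameter_le hμ hν hc hM hG ht0 ht1 hr1
      nlinarith [mul_le_mul_of_nonneg_left hle' ht0]
    · push Not at hg
      -- Here g(r) < 0 < g(1), so g vanishes at some ρ between r and 1.
      obtain ⟨ρ, ⟨hρr, hρ1⟩, hρ⟩ : (0 : ℝ) ∈ (fun r : ℝ =>
          μ * ((1 - t ^ 2) * r ^ 2 - ν * t ^ 2) - 4 * ν * t ^ 2 * r) '' Set.Icc r 1 := by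
        apply intermediate_value_Icc hr1 (by fun_prop)
        exact ⟨hg.le, by nlinarith⟩
      simp only at hρ
      have hρ0 : 0 ≤ ρ := hr0.trans hρr
      refine (hlin ρ hρr).trans ?_
      have h0 : 0 ≤ (1 - t ^ 2) * ρ ^ 2 - ν * t ^ 2 := by
        have : 0 ≤ 4 * ν * t ^ 2 * ρ := by positivity
        exact nonneg_of_mul_nonneg_right (by linarith) hμ0
      have h00 : 0 ≤ (1 - t ^ 2) * (μ * ρ + ρ ^ 2) - ν * t ^ 2 := by
        have : 0 ≤ (1 - t ^ 2) * (μ * ρ) := by positivity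
        linarith
      have h1 : (ν * t ^ 2 + (1 - t ^ 2) * ρ ^ 2) * κ =
          t * ((1 - t ^ 2) * (μ * ρ + ρ ^ 2) - ν * t ^ 2) := by
        refine (pow_left_inj₀ (by positivity) (by positivity) two_ne_zero).1 ?_
        rw [mul_pow, hκ2]
        have hρ' : μ * (ν * t ^ 2 - (1 - t ^ 2) * ρ ^ 2) = -(4 * ν * t ^ 2 * ρ) := by linarith
        have : (ν * t ^ 2 + (1 - t ^ 2) * ρ ^ 2) ^ 2 *
            (t ^ 2 + (1 - t ^ 2) * (μ ^ 2 / (4 * ν))) -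
            (t * ((1 - t ^ 2) * (μ * ρ + ρ ^ 2) - ν * t ^ 2)) ^ 2 = (1 - t ^ 2) *
            (-(4 * ν * t ^ 2 * ρ) - μ * (ν * t ^ 2 - (1 - t ^ 2) * ρ ^ 2)) ^ 2 / (4 * ν) := by
          field_simp; ring
        rw [hρ', sub_self, zero_pow two_ne_zero, mul_zero, zero_div] at this
        exact sub_eq_zero.1 this
      rw [h1]
      exact real_parameter_le hμ hν hc hM hG ht0 ht1 hρ1

/-- Here κ ≤ 1, and dropping it cancels r: the bound becomes (1-t²) + νt², a mean of 1 and ν. -/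
lemma le_of_sq_le_four_mul {μ ν M t r w N : ℝ} (hν : 0 < ν) (hc : μ ^ 2 ≤ 4 * ν)
    (hM : 1 ≤ M) (hMν : ν ≤ M) (ht0 : 0 ≤ t) (ht1 : t ≤ 1)
    (hN : N ^ 2 = (1 - t ^ 2) ^ 2 * μ ^ 2 * r ^ 2 + (ν * t ^ 2 + (1 - t ^ 2) * r ^ 2) ^ 2 +
      2 * (1 - t ^ 2) * μ * (ν * t ^ 2 - (1 - t ^ 2) * r ^ 2) * w -
      4 * ν * t ^ 2 * (1 - t ^ 2) * w ^ 2) :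
    (1 - t ^ 2) * (1 - r ^ 2) + t * N ≤ M := by
  have hT1 : t ^ 2 ≤ 1 := by nlinarith
  have hs : 0 ≤ 1 - t ^ 2 := by linarith
  have hc1 : μ ^ 2 / (4 * ν) ≤ 1 := by rw [div_le_iff₀ (by linarith)]; linarith
  have htN : t * N ≤ ν * t ^ 2 + (1 - t ^ 2) * r ^ 2 := by
    refine le_of_sq_le_sq_of_nonneg ?_ (by positivity)
    refine (sq_mul_sq_le hν hT1 hN).trans ?_
    refine mul_le_of_le_one_right (sq_nonneg _) ?_
    nlinarith
  nlinarith [sq_nonneg t]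

/-- Equality holds at t = 1. With q = νt² + η, the claim is q²(1 + ηe) ≤ ν²; since ν² - q² =
η(ν-1)(ν+q), it reduces to e q² ≤ (ν-1)(ν+q). The condition μ² + 8 ≤ 12ν is exactly eν ≤ 2(ν-1). -/
lemma critical_value_le_sq {μ ν t : ℝ} (hν1 : 1 ≤ ν) (hν : μ ^ 2 + 8 ≤ 12 * ν) (ht0 : 0 ≤ t)
    (ht1 : t ≤ 1) :
    (ν * t ^ 2 + (1 - t ^ 2)) ^ 2 * (t ^ 2 + (1 - t ^ 2) * (μ ^ 2 / (4 * ν))) ≤ ν ^ 2 := by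
  have hν0 : 0 < ν := by linarith
  have hs : 0 ≤ 1 - t ^ 2 := by nlinarith
  set η := 1 - t ^ 2 with hη
  set e := μ ^ 2 / (4 * ν) - 1 with he
  have hT : t ^ 2 = 1 - η := by rw [hη]; ring
  have heν : e * ν ≤ 2 * (ν - 1) := by
    have : e * ν = μ ^ 2 / 4 - ν := by rw [he]; field_simp
    linarith
  set q := ν - η * (ν - 1) with hq
  have hη1 : η ≤ 1 := by nlinarith [sq_nonneg t]
  have hq0 : 0 ≤ q := by nlinarith
  have hqν : q ≤ ν := by nlinarith
  have h1 : e * q ^ 2 ≤ (ν - 1) * (ν + q) := by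
    have h2 : ν * (e * q ^ 2) ≤ ν * ((ν - 1) * (ν + q)) := by
      have h3 : (e * ν) * q ^ 2 ≤ 2 * (ν - 1) * q ^ 2 :=
        mul_le_mul_of_nonneg_right heν (sq_nonneg _)
      have h4 : 0 ≤ (ν - 1) * ((ν - q) * (ν + 2 * q)) :=
        mul_nonneg (by linarith) (mul_nonneg (by linarith) (by linarith))
      nlinarith
    exact le_of_mul_le_mul_left h2 hν0
  have h5 : (ν * t ^ 2 + η) ^ 2 * (t ^ 2 + η * (μ ^ 2 / (4 * ν))) = q ^ 2 * (1 + η * e) := by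
    rw [hq, he, hT]; ring
  rw [h5]
  have h6 : η * (e * q ^ 2) ≤ η * ((ν - 1) * (ν + q)) := mul_le_mul_of_nonneg_left h1 hs
  have h7 : η * (ν - 1) = ν - q := by rw [hq]; ring
  nlinarith

lemma le_of_sq_add_eight_le {μ ν t r w N : ℝ} (hμ : 4 ≤ μ ^ 2) (hν : μ ^ 2 + 8 ≤ 12 * ν)
    (ht0 : 0 ≤ t) (ht1 : t ≤ 1) (hr0 : 0 ≤ r) (hr1 : r ≤ 1)
    (hN : N ^ 2 = (1 - t ^ 2) ^ 2 * μ ^ 2 * r ^ 2 + (ν * t ^ 2 + (1 - t ^ 2) * r ^ 2) ^ 2 +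
      2 * (1 - t ^ 2) * μ * (ν * t ^ 2 - (1 - t ^ 2) * r ^ 2) * w -
      4 * ν * t ^ 2 * (1 - t ^ 2) * w ^ 2) :
    (1 - t ^ 2) * (1 - r ^ 2) + t * N ≤ ν := by
  have hν1 : 1 ≤ ν := by linarith
  have hν0 : 0 < ν := by linarith
  rcases le_total (μ ^ 2) (4 * ν) with hc | hc
  · exact le_of_sq_le_four_mul hν0 hc hν1 le_rfl ht0 ht1 hN
  have hT1 : t ^ 2 ≤ 1 := by nlinarith
  have hs : 0 ≤ 1 - t ^ 2 := by linarith
  have hc1 : 1 ≤ μ ^ 2 / (4 * ν) := by rw [le_div_iff₀ (by linarith)]; linarith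
  obtain ⟨κ, hκ1, hκ2, htN⟩ := exists_mul_le_mul hν0 hc hT1 hN
  have hmax : (ν * t ^ 2 + (1 - t ^ 2)) * κ ≤ ν := by
    refine le_of_sq_le_sq_of_nonneg ?_ hν0.le
    rw [mul_pow, hκ2]
    exact critical_value_le_sq hν1 hν ht0 ht1
  have h2 : 0 ≤ (1 - t ^ 2) * ((1 - r ^ 2) * (κ - 1)) :=
    mul_nonneg hs (mul_nonneg (by nlinarith) (by linarith))
  nlinarith

lemma le_one_of_nonpos {μ ν t r N : ℝ} (hμ : μ ≤ 1 / 2) (hν1 : -1 ≤ ν)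
    (ht0 : 0 ≤ t) (ht1 : t ≤ 1) (hr0 : 0 ≤ r) (hr1 : r ≤ 1)
    (hN : N ≤ -ν * t ^ 2 + (1 - t ^ 2) * (μ * r + r ^ 2)) :
    (1 - t ^ 2) * (1 - r ^ 2) + t * N ≤ 1 := by
  have hs : 0 ≤ 1 - t ^ 2 := by nlinarith
  have h1 : N ≤ t ^ 2 + (1 - t ^ 2) * (r / 2 + r ^ 2) := by
    have h2 : 0 ≤ (1 - t ^ 2) * ((1 / 2 - μ) * r) := mul_nonneg hs (mul_nonneg (by linarith) hr0)
    nlinarith [sq_nonneg t]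
  have h3 : t * N ≤ t * (t ^ 2 + (1 - t ^ 2) * (r / 2 + r ^ 2)) :=
    mul_le_mul_of_nonneg_left h1 ht0
  -- This is the claim after the factor 1 - t has been removed. The quadratic in r has vertex
  -- t/(4(1-t)), which is at most 1 precisely for t ≤ 4/5.
  have h4 : (1 + t) * (t * r / 2 - (1 - t) * r ^ 2) ≤ t ^ 2 := by
    by_cases h5 : t ≤ 4 / 5
    · have h6 : 0 ≤ (1 + t) * (t - 4 * (1 - t) * r) ^ 2 :=
        mul_nonneg (by linarith) (sq_nonneg _)
      have h7 : 0 ≤ t ^ 2 * (15 - 17 * t) := mul_nonneg (sq_nonneg _) (by linarith)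
      refine le_of_mul_le_mul_left (a := 16 * (1 - t)) ?_ (by linarith)
      linarith
    · push Not at h5
      have h6 : t * r / 2 - (1 - t) * r ^ 2 ≤ t / 2 - (1 - t) := by
        have : 0 ≤ (1 - r) * (t / 2 - (1 - t) * (1 + r)) :=
          mul_nonneg (by linarith) (by nlinarith)
        nlinarith
      nlinarith
  nlinarith [mul_le_mul_of_nonneg_left h4 (sub_nonneg.2 ht1)]

/-! ### Taylor coefficients and logarithmic coefficients -/

open Complex Filter Topology Metric Set ComplexConjugate

/-- The Taylor coefficients at `0`. -/
noncomputable def coef (f : ℂ → ℂ) (n : ℕ) : ℂ := iteratedDeriv n f 0 / (n.factorial : ℂ)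

lemma coef_congr {f g : ℂ → ℂ} (h : f =ᶠ[𝓝 0] g) (n : ℕ) : coef f n = coef g n := by
  rw [coef, coef, (h.iteratedDeriv n).eq_of_nhds]

lemma coef_zero (f : ℂ → ℂ) : coef f 0 = f 0 := by simp [coef]

lemma coef_deriv (f : ℂ → ℂ) (n : ℕ) : coef (deriv f) n = (n + 1) * coef f (n + 1) := by
  have h1 : ((n : ℂ) + 1) ≠ 0 := Nat.cast_add_one_ne_zero n
  have h2 : (n.factorial : ℂ) ≠ 0 := Nat.cast_ne_zero.2 n.factorial_ne_zero
  rw [coef, coef, iteratedDeriv_succ', Nat.factorial_succ]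
  push_cast
  field_simp

lemma coef_mul {f g : ℂ → ℂ} (hf : AnalyticAt ℂ f 0) (hg : AnalyticAt ℂ g 0) (n : ℕ) :
    coef (fun z => f z * g z) n = ∑ i ∈ Finset.range (n + 1), coef f i * coef g (n - i) := by
  rw [coef, iteratedDeriv_fun_mul hf.contDiffAt hg.contDiffAt, Finset.sum_div]
  refine Finset.sum_congr rfl fun i hi => ?_
  have hi' : i ≤ n := Nat.lt_succ_iff.1 (Finset.mem_range.1 hi)
  rw [coef, coef, Nat.cast_choose ℂ hi']
  have h1 : (n.factorial : ℂ) ≠ 0 := Nat.cast_ne_zero.2 n.factorial_ne_zero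
  have h2 : (i.factorial : ℂ) ≠ 0 := Nat.cast_ne_zero.2 i.factorial_ne_zero
  have h3 : ((n - i).factorial : ℂ) ≠ 0 := Nat.cast_ne_zero.2 (n - i).factorial_ne_zero
  field_simp

lemma coef_add {f g : ℂ → ℂ} (hf : AnalyticAt ℂ f 0) (hg : AnalyticAt ℂ g 0) (n : ℕ) :
    coef (fun z => f z + g z) n = coef f n + coef g n := by
  rw [coef, iteratedDeriv_fun_add hf.contDiffAt hg.contDiffAt, add_div, coef, coef]

lemma coef_const (c : ℂ) (n : ℕ) : coef (fun _ => c) (n + 1) = 0 := by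
  simp [coef, iteratedDeriv_const]

lemma coef_const_mul {f : ℂ → ℂ} (c : ℂ) (n : ℕ) :
    coef (fun z => c * f z) n = c * coef f n := by
  simp [coef, mul_div_assoc]

lemma coef_pow (k n : ℕ) : coef (fun z => z ^ k) n = if n = k then 1 else 0 := by
  have h : (k.factorial : ℂ) ≠ 0 := Nat.cast_ne_zero.2 k.factorial_ne_zero
  rw [coef, iteratedDeriv_fun_pow_zero]
  split_ifs with hk
  · subst hk; simp [h]
  · simp

lemma coef_id_mul_succ {f : ℂ → ℂ} (hf : AnalyticAt ℂ f 0) (n : ℕ) :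
    coef (fun z => z * f z) (n + 1) = coef f n := by
  have h : ∀ n, coef (fun z : ℂ => z) n = if n = 1 then 1 else 0 := fun n => by
    simpa using coef_pow 1 n
  rw [coef_mul (f := fun z => z) analyticAt_id hf, Finset.sum_eq_single 1]
  · rw [h]; simp
  · intro i _ hi; rw [h, if_neg hi, zero_mul]
  · intro h'; simp at h'

/-- The logarithmic coefficients of `f` through the Taylor coefficients of `ω`, where
`1 + z f'' / f' = (1 + A ω) / (1 + B ω)`. -/
lemma logCoeff_eq {A B : ℝ} {f ω : ℂ → ℂ} (hf : AnalyticAt ℂ f 0) (hf0 : f 0 = 0)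
    (hf1 : deriv f 0 = 1) (hω : AnalyticAt ℂ ω 0) (hω0 : ω 0 = 0)
    (h : ∀ᶠ z in 𝓝 0, 1 + z * deriv (deriv f) z / deriv f z =
      (1 + (A : ℂ) * ω z) / (1 + (B : ℂ) * ω z)) :
    logCoeff f 1 = (A - B) / 4 * coef ω 1 ∧
    logCoeff f 2 = (A - B) / 12 * (coef ω 2 + (A - 5 * B) / 4 * coef ω 1 ^ 2) ∧
    logCoeff f 3 = (A - B) / 24 * (coef ω 3 + (A - 5 * B) / 2 * coef ω 1 * coef ω 2 +
      (3 * B ^ 2 - A * B) / 2 * coef ω 1 ^ 3) := by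
  have hg : AnalyticAt ℂ (deriv f) 0 := hf.deriv
  have hdg : AnalyticAt ℂ (deriv (deriv f)) 0 := hg.deriv
  have hid : AnalyticAt ℂ (fun z : ℂ => z) 0 := analyticAt_id
  have hden : ∀ᶠ z in 𝓝 0, 1 + (B : ℂ) * ω z ≠ 0 := by
    have : ContinuousAt (fun z => 1 + (B : ℂ) * ω z) 0 :=
      continuousAt_const.add (continuousAt_const.mul hω.continuousAt)
    exact this.eventually_ne (by simp [hω0])
  have hfne : ∀ᶠ z in 𝓝 0, deriv f z ≠ 0 := hg.continuousAt.eventually_ne (by simp [hf1])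
  -- With denominators cleared, the equation is linear in f' and gives a recursion for its
  -- coefficients.
  have heq : (fun z => z * deriv (deriv f) z + (B : ℂ) * (ω z * (z * deriv (deriv f) z))) =ᶠ[𝓝 0]
      (fun z => ((A : ℂ) - B) * (ω z * deriv f z)) := by
    filter_upwards [h, hden, hfne] with z h1 h2 h3
    rw [eq_div_iff h2] at h1
    linear_combination deriv f z * h1 -
      (1 + B * ω z) * div_mul_cancel₀ (z * deriv (deriv f) z) h3
  have hu : AnalyticAt ℂ (fun z => z * deriv (deriv f) z) 0 := hid.fun_mul hdg
  have hcu : ∀ n, coef (fun z => z * deriv (deriv f) z) n = n * coef (deriv f) n := by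
    intro n
    cases n with
    | zero => simp [coef_zero]
    | succ n => rw [coef_id_mul_succ hdg, coef_deriv]; push_cast; rfl
  have hω0' : coef ω 0 = 0 := by rw [coef_zero, hω0]
  have hg0 : coef (deriv f) 0 = 1 := by rw [coef_zero, hf1]
  have hrel : ∀ n, n * coef (deriv f) n + (B : ℂ) * ∑ i ∈ Finset.range (n + 1),
      coef ω i * ((n - i : ℕ) * coef (deriv f) (n - i)) =
      ((A : ℂ) - B) * ∑ i ∈ Finset.range (n + 1), coef ω i * coef (deriv f) (n - i) := by
    intro n
    have := coef_congr heq n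
    rw [coef_add hu (analyticAt_const.fun_mul (hω.fun_mul hu)), coef_const_mul, coef_const_mul,
      coef_mul hω hu, coef_mul hω hg, hcu] at this
    simpa only [hcu] using this
  have r1 := hrel 1
  have r2 := hrel 2
  have r3 := hrel 3
  simp only [Finset.sum_range_succ, Finset.range_zero, Finset.sum_empty, hω0', hg0] at r1 r2 r3
  norm_num at r1 r2 r3
  have hh : AnalyticAt ℂ (dslope f 0) 0 := by
    obtain ⟨p, hp⟩ := hf
    exact hp.has_fpower_series_dslope_fslope.analyticAt
  have hfh : f = fun z => z * dslope f 0 z := by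
    funext z
    have := sub_smul_dslope f 0 z
    simpa [hf0] using this.symm
  have hh0 : dslope f 0 0 = 1 := by rw [dslope_same, hf1]
  have hgh : ∀ n, coef (deriv f) n = (n + 1) * coef (dslope f 0) n := by
    intro n
    rw [coef_deriv, ← coef_id_mul_succ hh, ← hfh]
  have hslit : dslope f 0 0 ∈ slitPlane := by rw [hh0]; exact one_mem_slitPlane
  have hL : AnalyticAt ℂ (fun z => log (dslope f 0 z)) 0 := hh.clog hslit
  -- For h = f/z and L = log h, the identity h L' = h' gives a recursion for the coefficients of L.
  have hLeq : (fun z => dslope f 0 z * deriv (fun z => log (dslope f 0 z)) z) =ᶠ[𝓝 0]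
      deriv (dslope f 0) := by
    have h1 : ∀ᶠ z in 𝓝 0, dslope f 0 z ∈ slitPlane :=
      hh.continuousAt.eventually (isOpen_slitPlane.mem_nhds hslit)
    filter_upwards [h1, hh.eventually_analyticAt] with z hz hz'
    have hne : dslope f 0 z ≠ 0 := slitPlane_ne_zero hz
    rw [(hz'.differentiableAt.hasDerivAt.clog hz).deriv]
    field_simp
  have hh0' : coef (dslope f 0) 0 = 1 := by rw [coef_zero, hh0]
  have hLrel : ∀ n : ℕ, ∑ i ∈ Finset.range (n + 1), coef (dslope f 0) i *
      (((n - i : ℕ) + 1) * coef (fun z => log (dslope f 0 z)) (n - i + 1)) =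
      (n + 1) * coef (dslope f 0) (n + 1) := by
    intro n
    have := coef_congr hLeq n
    rw [coef_mul hh hL.deriv, coef_deriv] at this
    simpa only [coef_deriv] using this
  have l0 := hLrel 0
  have l1 := hLrel 1
  have l2 := hLrel 2
  have g1 := hgh 1
  have g2 := hgh 2
  have g3 := hgh 3
  simp only [Finset.sum_range_succ, Finset.range_zero, Finset.sum_empty, hh0'] at l0 l1 l2
  norm_num at l0 l1 l2 g1 g2 g3
  have hlog : ∀ n, logCoeff f n = coef (fun z => log (dslope f 0 z)) n / 2 := fun n => rfl
  rw [hlog, hlog, hlog]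
  generalize coef (fun z => log (dslope f 0 z)) = l at *
  generalize coef (dslope f 0) = k at *
  generalize coef (deriv f) = g at *
  generalize coef ω = c at *
  have E1 : g 1 = (A - B) * c 1 := by linear_combination r1
  have E2 : g 2 = (A - B) * (c 2 + c 1 * g 1) / 2 - B * c 1 * g 1 / 2 := by
    linear_combination r2 / 2
  have E3 : g 3 = (A - B) * (c 3 + c 2 * g 1 + c 1 * g 2) / 3
      - B * (2 * c 1 * g 2 + c 2 * g 1) / 3 := by
    linear_combination r3 / 3
  have K1 : k 1 = g 1 / 2 := by linear_combination -g1 / 2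
  have K2 : k 2 = g 2 / 3 := by linear_combination -g2 / 3
  have K3 : k 3 = g 3 / 4 := by linear_combination -g3 / 4
  have L1 : l 1 = k 1 := by linear_combination l0
  have L2 : l 2 = k 2 - k 1 * l 1 / 2 := by linear_combination l1 / 2
  have L3 : l 3 = k 3 - (2 * k 1 * l 2 + k 2 * l 1) / 3 := by linear_combination l2 / 3
  refine ⟨?_, ?_, ?_⟩
  · rw [L1, K1, E1]; ring
  · rw [L2, L1, K2, K1, E2, E1]; ring
  · rw [L3, L2, L1, K3, K2, K1, E3, E2, E1]; ring

/-! ### Schur parameters of a Schwarz function -/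

/-- One step of the Schur algorithm. -/
lemma schur_step {φ : ℂ → ℂ} (hφ : DifferentiableOn ℂ φ (ball 0 1))
    (hφ1 : ∀ z ∈ ball (0 : ℂ) 1, ‖φ z‖ ≤ 1) :
    ∃ χ : ℂ → ℂ, DifferentiableOn ℂ χ (ball 0 1) ∧ (∀ z ∈ ball (0 : ℂ) 1, ‖χ z‖ ≤ 1) ∧
      ∀ z ∈ ball (0 : ℂ) 1, φ z * (1 + conj (φ 0) * (z * χ z)) = φ 0 + z * χ z := by
  have h0 : (0 : ℂ) ∈ ball (0 : ℂ) 1 := mem_ball_self one_pos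
  rcases (hφ1 0 h0).eq_or_lt with ha | ha
  -- If |φ(0)| = 1, the maximum principle makes φ constant and χ = 0 works; the relation is stated
  -- without division so as to cover this case.
  · refine ⟨fun _ => 0, differentiableOn_const _, by simp, fun z hz => ?_⟩
    have hmax : IsMaxOn (norm ∘ φ) (ball 0 1) 0 :=
      isMaxOn_iff.2 fun z hz => by simpa [ha] using hφ1 z hz
    have := eqOn_of_isPreconnected_of_isMaxOn_norm (convex_ball (0 : ℂ) 1).isPreconnected
      isOpen_ball hφ h0 hmax hz
    simpa using this
  · set a := φ 0 with hadef
    have hne : ∀ z ∈ ball (0 : ℂ) 1, 1 - conj a * φ z ≠ 0 := by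
      intro z hz h
      have h1 : ‖conj a * φ z‖ < 1 := by
        rw [norm_mul, RCLike.norm_conj]
        nlinarith [hφ1 z hz, norm_nonneg a, norm_nonneg (φ z)]
      rw [← sub_eq_zero.1 h, norm_one] at h1
      exact lt_irrefl _ h1
    set ψ : ℂ → ℂ := fun z => (φ z - a) / (1 - conj a * φ z) with hψ
    have hψd : DifferentiableOn ℂ ψ (ball 0 1) :=
      (hφ.sub_const a).div ((differentiableOn_const _).sub (hφ.const_mul _)) hne
    have hψ0 : ψ 0 = 0 := by simp [hψ, ← hadef]
    have hψ1 : MapsTo ψ (ball 0 1) (closedBall (ψ 0) 1) := by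
      intro z hz
      rw [hψ0, mem_closedBall_zero_iff]
      change ‖(φ z - a) / (1 - conj a * φ z)‖ ≤ 1
      rw [norm_div, div_le_one (norm_pos_iff.2 (hne z hz))]
      refine le_of_sq_le_sq_of_nonneg ?_ (norm_nonneg _)
      have h1 : normSq (φ z) ≤ 1 := by
        rw [normSq_eq_norm_sq]; nlinarith [hφ1 z hz, norm_nonneg (φ z)]
      have h2 : normSq a ≤ 1 := by
        rw [normSq_eq_norm_sq]; nlinarith [norm_nonneg a]
      rw [← normSq_eq_norm_sq, ← normSq_eq_norm_sq]
      have h3 : normSq (1 - conj a * φ z) - normSq (φ z - a) =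
          (1 - normSq a) * (1 - normSq (φ z)) := by
        simp only [normSq_apply, sub_re, sub_im, mul_re, mul_im, conj_re, conj_im, one_re, one_im]
        ring
      nlinarith [mul_nonneg (sub_nonneg.2 h2) (sub_nonneg.2 h1)]
    have hzχ : ∀ z, z * dslope ψ 0 z = ψ z := by
      intro z
      have := sub_smul_dslope ψ 0 z
      simpa [hψ0] using this
    refine ⟨dslope ψ 0, (differentiableOn_dslope (ball_mem_nhds _ one_pos)).2 hψd,
      fun z hz => ?_, fun z hz => ?_⟩
    · simpa using norm_dslope_le_div_of_mapsTo_ball hψd hψ1 hz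
    · rw [hzχ]
      linear_combination -div_mul_cancel₀ (φ z - a) (hne z hz)

/-- The parametrization of the first three coefficients of a Schwarz function. -/
lemma exists_schwarz_parameters {ω : ℂ → ℂ} (hω : AnalyticOnNhd ℂ ω unitDisk)
    (hm : MapsTo ω unitDisk unitDisk) (hω0 : ω 0 = 0) :
    ‖coef ω 1‖ ≤ 1 ∧ ∃ x y : ℂ, ‖x‖ ≤ 1 ∧ ‖y‖ ≤ 1 - ‖x‖ ^ 2 ∧
      coef ω 2 = (1 - ‖coef ω 1‖ ^ 2 : ℝ) * x ∧
      coef ω 3 = (1 - ‖coef ω 1‖ ^ 2 : ℝ) * (y - conj (coef ω 1) * x ^ 2) := by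
  have h0 : (0 : ℂ) ∈ ball (0 : ℂ) 1 := mem_ball_self one_pos
  have hnhds : ball (0 : ℂ) 1 ∈ 𝓝 (0 : ℂ) := ball_mem_nhds _ one_pos
  have hid : AnalyticAt ℂ (fun z : ℂ => z) 0 := analyticAt_id
  have hωd : DifferentiableOn ℂ ω (ball 0 1) := hω.differentiableOn
  have hm' : MapsTo ω (ball 0 1) (closedBall (ω 0) 1) := by
    rw [hω0]; exact hm.mono_right ball_subset_closedBall
  have hφd : DifferentiableOn ℂ (dslope ω 0) (ball 0 1) :=
    (differentiableOn_dslope hnhds).2 hωd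
  have hφ1 : ∀ z ∈ ball (0 : ℂ) 1, ‖dslope ω 0 z‖ ≤ 1 := fun z hz => by
    simpa using norm_dslope_le_div_of_mapsTo_ball hωd hm' hz
  have hωφ : ω = fun z => z * dslope ω 0 z := by
    funext z
    have := sub_smul_dslope ω 0 z
    simpa [hω0] using this.symm
  set φ := dslope ω 0
  have hφa : AnalyticAt ℂ φ 0 := hφd.analyticAt hnhds
  have hcφ : ∀ n, coef ω (n + 1) = coef φ n := fun n => by
    rw [← coef_id_mul_succ hφa, ← hωφ]
  obtain ⟨χ, hχd, hχ1, hχ⟩ := schur_step hφd hφ1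
  obtain ⟨θ, hθd, hθ1, hθ⟩ := schur_step hχd hχ1
  have hχa : AnalyticAt ℂ χ 0 := hχd.analyticAt hnhds
  have hθa : AnalyticAt ℂ θ 0 := hθd.analyticAt hnhds
  have hrel : ∀ {u v : ℂ → ℂ}, AnalyticAt ℂ u 0 → AnalyticAt ℂ v 0 →
      (∀ z ∈ ball (0 : ℂ) 1, u z * (1 + conj (u 0) * (z * v z)) = u 0 + z * v z) → ∀ n,
      coef u (n + 1) + conj (u 0) * ∑ i ∈ Finset.range (n + 1), coef u i * coef v (n - i) =
        coef v n := by
    intro u v hu hv huv n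
    have hE : (fun z => u z + conj (u 0) * (z * (u z * v z))) =ᶠ[𝓝 0]
        fun z => u 0 + z * v z := by
      filter_upwards [hnhds] with z hz
      rw [← huv z hz]; ring
    have := coef_congr hE (n + 1)
    rwa [coef_add hu (analyticAt_const.fun_mul (hid.fun_mul (hu.fun_mul hv))), coef_const_mul,
      coef_id_mul_succ (hu.fun_mul hv), coef_add analyticAt_const (hid.fun_mul hv), coef_const,
      coef_id_mul_succ hv, zero_add, coef_mul hu hv] at this
  have r0 := hrel hφa hχa hχ 0
  have r1 := hrel hφa hχa hχ 1
  have r2 := hrel hχa hθa hθ 0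
  simp only [Finset.sum_range_succ, Finset.range_zero, Finset.sum_empty, zero_add,
    Nat.sub_self, Nat.sub_zero, coef_zero] at r0 r1 r2
  have hn : ∀ z : ℂ, ((1 - ‖z‖ ^ 2 : ℝ) : ℂ) = 1 - conj z * z := by
    intro z; rw [conj_mul']; push_cast; ring
  have c1 : coef ω 1 = φ 0 := by rw [hcφ 0, coef_zero]
  -- The second Schur step gives χ'(0) = (1 - |χ(0)|²)θ(0), whence the bound on y.
  refine ⟨?_, χ 0, coef χ 1, hχ1 0 h0, ?_, ?_, ?_⟩
  · rw [c1]; exact hφ1 0 h0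
  · have h1 : coef χ 1 = (1 - ‖χ 0‖ ^ 2 : ℝ) * θ 0 := by
      rw [hn]; linear_combination r2
    have h2 : 0 ≤ 1 - ‖χ 0‖ ^ 2 := by nlinarith [hχ1 0 h0, norm_nonneg (χ 0)]
    rw [h1, norm_mul, norm_real, Real.norm_of_nonneg h2]
    exact mul_le_of_le_one_right h2 (hθ1 0 h0)
  · rw [c1, hn, hcφ 1]; linear_combination r0
  · rw [c1, hn, hcφ 2]
    linear_combination r1 - conj (φ 0) * χ 0 * r0

/-! ### Janowski convex functions from Schwarz functions -/

lemma one_add_mul_ne_zero {B : ℝ} (hB : |B| ≤ 1) {w : ℂ} (hw : w ∈ unitDisk) :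
    1 + (B : ℂ) * w ≠ 0 := by
  intro h
  have hw1 : ‖w‖ < 1 := mem_ball_zero_iff.1 hw
  have h1 : ‖(B : ℂ) * w‖ < 1 := by
    rw [norm_mul, norm_real, Real.norm_eq_abs]
    nlinarith [norm_nonneg w, abs_nonneg B]
  rw [eq_neg_of_add_eq_zero_right h, norm_neg, norm_one] at h1
  exact lt_irrefl _ h1

/-- Every Schwarz function `ω` comes from a Janowski convex function. -/
lemma exists_classC_of_schwarz (A : ℝ) {B : ℝ} (hB : |B| ≤ 1) {ω : ℂ → ℂ}
    (hω : AnalyticOnNhd ℂ ω unitDisk) (hm : MapsTo ω unitDisk unitDisk) (hω0 : ω 0 = 0) :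
    ∃ f ∈ classC A B, ∀ z ∈ unitDisk, 1 + z * deriv (deriv f) z / deriv f z =
      (1 + (A : ℂ) * ω z) / (1 + (B : ℂ) * ω z) := by
  have h0 : (0 : ℂ) ∈ unitDisk := mem_ball_self one_pos
  have hne : ∀ z ∈ unitDisk, 1 + (B : ℂ) * ω z ≠ 0 := fun z hz =>
    one_add_mul_ne_zero hB (hm hz)
  have hωd : DifferentiableOn ℂ ω (ball 0 1) := hω.differentiableOn
  have hφd : DifferentiableOn ℂ (dslope ω 0) (ball 0 1) :=
    (differentiableOn_dslope (ball_mem_nhds _ one_pos)).2 hωd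
  -- H is the required f''/f', with ω/z as `dslope`; integrating, exponentiating and integrating
  -- again yields f.
  set H : ℂ → ℂ := fun z => ((A : ℂ) - B) * dslope ω 0 z / (1 + (B : ℂ) * ω z) with hH
  have hHd : DifferentiableOn ℂ H (ball 0 1) :=
    (hφd.const_mul _).div ((differentiableOn_const _).add (hωd.const_mul _)) hne
  obtain ⟨F, hF0, hF⟩ := hHd.isExactOn_ball.with_val_at 0 0
  have hgd : DifferentiableOn ℂ (fun z => exp (F z)) (ball 0 1) := fun z hz =>
    (hF z hz).cexp.differentiableAt.differentiableWithinAt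
  obtain ⟨f, hf0, hf⟩ := hgd.isExactOn_ball.with_val_at 0 0
  have hd1 : ∀ z ∈ unitDisk, deriv f z = exp (F z) := fun z hz => (hf z hz).deriv
  have hd2 : ∀ z ∈ unitDisk, deriv (deriv f) z = exp (F z) * H z := by
    intro z hz
    have : deriv f =ᶠ[𝓝 z] fun z => exp (F z) := by
      filter_upwards [isOpen_ball.mem_nhds hz] with w hw using hd1 w hw
    rw [this.deriv_eq, (hF z hz).cexp.deriv]
  have hsub : ∀ z ∈ unitDisk, 1 + z * deriv (deriv f) z / deriv f z =
      (1 + (A : ℂ) * ω z) / (1 + (B : ℂ) * ω z) := by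
    intro z hz
    have h1 : z * dslope ω 0 z = ω z := by
      have := sub_smul_dslope ω 0 z
      simpa [hω0] using this
    have h2 : z * (exp (F z) * H z) / exp (F z) = z * H z := by
      field_simp [exp_ne_zero (F z)]
    rw [hd1 z hz, hd2 z hz, h2, eq_div_iff (hne z hz)]
    have h3 : H z * (1 + (B : ℂ) * ω z) = ((A : ℂ) - B) * dslope ω 0 z :=
      div_mul_cancel₀ _ (hne z hz)
    linear_combination z * h3 + ((A : ℂ) - B) * h1
  refine ⟨f, ⟨⟨?_, hf0, ?_⟩, fun z hz => ?_, ω, hω, hm, hω0, hsub⟩, hsub⟩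
  · exact DifferentiableOn.analyticOnNhd
      (fun z hz => (hf z hz).differentiableAt.differentiableWithinAt) isOpen_ball
  · rw [hd1 0 h0, hF0, exp_zero]
  · rw [hd1 z hz]; exact exp_ne_zero _

/-- The values of the logarithmic coefficients in `C(A, B)` are those of functionals on Schwarz
functions. -/
lemma exists_schwarz_of_mem_classC {A B : ℝ} {f : ℂ → ℂ} (hf : f ∈ classC A B) :
    ∃ ω : ℂ → ℂ, AnalyticOnNhd ℂ ω unitDisk ∧ MapsTo ω unitDisk unitDisk ∧ ω 0 = 0 ∧
    logCoeff f 1 = (A - B) / 4 * coef ω 1 ∧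
    logCoeff f 2 = (A - B) / 12 * (coef ω 2 + (A - 5 * B) / 4 * coef ω 1 ^ 2) ∧
    logCoeff f 3 = (A - B) / 24 * (coef ω 3 + (A - 5 * B) / 2 * coef ω 1 * coef ω 2 +
      (3 * B ^ 2 - A * B) / 2 * coef ω 1 ^ 3) := by
  obtain ⟨⟨hfa, hf0, hf1⟩, -, ω, hω, hm, hω0, hsub⟩ := hf
  have h0 : (0 : ℂ) ∈ unitDisk := mem_ball_self one_pos
  refine ⟨ω, hω, hm, hω0, logCoeff_eq (hfa 0 h0) hf0 hf1 (hω 0 h0) hω0 ?_⟩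
  filter_upwards [isOpen_ball.mem_nhds h0] with z hz using hsub z hz

lemma exists_mem_classC_logCoeff (A : ℝ) {B : ℝ} (hB : |B| ≤ 1) {ω : ℂ → ℂ}
    (hω : AnalyticOnNhd ℂ ω unitDisk) (hm : MapsTo ω unitDisk unitDisk) (hω0 : ω 0 = 0) :
    ∃ f ∈ classC A B, logCoeff f 1 = (A - B) / 4 * coef ω 1 ∧
    logCoeff f 2 = (A - B) / 12 * (coef ω 2 + (A - 5 * B) / 4 * coef ω 1 ^ 2) ∧
    logCoeff f 3 = (A - B) / 24 * (coef ω 3 + (A - 5 * B) / 2 * coef ω 1 * coef ω 2 +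
      (3 * B ^ 2 - A * B) / 2 * coef ω 1 ^ 3) := by
  obtain ⟨f, hf, hsub⟩ := exists_classC_of_schwarz A hB hω hm hω0
  have h0 : (0 : ℂ) ∈ unitDisk := mem_ball_self one_pos
  refine ⟨f, hf, logCoeff_eq (hf.1.1 0 h0) hf.1.2.1 hf.1.2.2 (hω 0 h0) hω0 ?_⟩
  filter_upwards [isOpen_ball.mem_nhds h0] with z hz using hsub z hz

/-- The powers `zᵏ` as Schwarz functions. -/
lemma exists_mem_classC_pow (A : ℝ) {B : ℝ} (hB : |B| ≤ 1) {k : ℕ} (hk : k ≠ 0) :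
    ∃ f ∈ classC A B, logCoeff f 1 = (A - B) / 4 * (if 1 = k then 1 else 0) ∧
    logCoeff f 2 = (A - B) / 12 * ((if 2 = k then 1 else 0) +
      (A - 5 * B) / 4 * (if 1 = k then 1 else 0) ^ 2) ∧
    logCoeff f 3 = (A - B) / 24 * ((if 3 = k then 1 else 0) +
      (A - 5 * B) / 2 * (if 1 = k then 1 else 0) * (if 2 = k then 1 else 0) +
      (3 * B ^ 2 - A * B) / 2 * (if 1 = k then 1 else 0) ^ 3) := by
  have := exists_mem_classC_logCoeff A hB (ω := fun z => z ^ k)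
    (fun z _ => analyticAt_id.pow k) (fun z hz => ?_) (by simp [hk])
  · simpa only [coef_pow] using this
  · have hz1 : ‖z‖ < 1 := mem_ball_zero_iff.1 hz
    rw [unitDisk, mem_ball_zero_iff, norm_pow]
    exact pow_lt_one₀ (norm_nonneg _) hz1 hk

/-- The Schwarz function `z (t - ε z) / (1 - ε t z)` with its coefficients. -/
lemma exists_moebius_schwarz {t ε : ℝ} (ht0 : 0 ≤ t) (ht1 : t ≤ 1) (hε : ε ^ 2 = 1) :
    ∃ ω : ℂ → ℂ, AnalyticOnNhd ℂ ω unitDisk ∧ MapsTo ω unitDisk unitDisk ∧ ω 0 = 0 ∧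
      coef ω 1 = t ∧ coef ω 2 = -(ε * (1 - t ^ 2)) ∧ coef ω 3 = -(t * (1 - t ^ 2)) := by
  have hεc : (ε : ℂ) ^ 2 = 1 := by exact_mod_cast hε
  have hεa : |ε| = 1 := by
    rw [← abs_one, ← sq_eq_sq_iff_abs_eq_abs, hε, one_pow]
  have hne : ∀ z ∈ unitDisk, 1 - (ε * t : ℂ) * z ≠ 0 := by
    intro z hz
    have h : |-(ε * t)| ≤ 1 := by rw [abs_neg, abs_mul, hεa, one_mul, abs_of_nonneg ht0]; exact ht1
    have := one_add_mul_ne_zero h hz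
    push_cast at this
    intro h'
    apply this
    rw [← h']; ring
  set ω : ℂ → ℂ := fun z => z * (t - ε * z) / (1 - (ε * t : ℂ) * z) with hωdef
  have hωd : DifferentiableOn ℂ ω (ball 0 1) := by
    refine DifferentiableOn.div ?_ ?_ hne <;> fun_prop
  have hωa : AnalyticOnNhd ℂ ω unitDisk := hωd.analyticOnNhd isOpen_ball
  have h0 : (0 : ℂ) ∈ unitDisk := mem_ball_self one_pos
  have hω0 : ω 0 = 0 := by simp [hωdef]
  have hrel : (fun z => ω z + (-(ε * t) : ℂ) * (z * ω z)) =ᶠ[𝓝 0]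
      fun z => (t : ℂ) * z ^ 1 + (-ε : ℂ) * z ^ 2 := by
    filter_upwards [isOpen_ball.mem_nhds h0] with z hz
    linear_combination div_mul_cancel₀ (z * (t - ε * z)) (hne z hz)
  have ha := hωa 0 h0
  have hid : AnalyticAt ℂ (fun z : ℂ => z) 0 := analyticAt_id
  have hc : ∀ n, coef ω (n + 1) + (-(ε * t) : ℂ) * coef ω n =
      t * (if n + 1 = 1 then 1 else 0) + -ε * (if n + 1 = 2 then 1 else 0) := by
    intro n
    have := coef_congr hrel (n + 1)
    rwa [coef_add ha (analyticAt_const.fun_mul (hid.fun_mul ha)), coef_const_mul,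
      coef_id_mul_succ ha, coef_add (analyticAt_const.fun_mul (hid.fun_pow 1))
      (analyticAt_const.fun_mul (hid.fun_pow 2)), coef_const_mul, coef_const_mul, coef_pow,
      coef_pow] at this
  have c0 := hc 0
  have c1 := hc 1
  have c2 := hc 2
  rw [coef_zero, hω0] at c0
  norm_num at c0 c1 c2
  refine ⟨ω, hωa, fun z hz => ?_, hω0, c0, ?_, ?_⟩
  · have hz1 : ‖z‖ < 1 := mem_ball_zero_iff.1 hz
    rw [unitDisk, mem_ball_zero_iff]
    have h1 : ‖(t : ℂ) - ε * z‖ ≤ ‖1 - (ε * t : ℂ) * z‖ := by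
      refine le_of_sq_le_sq_of_nonneg ?_ (norm_nonneg _)
      rw [← normSq_eq_norm_sq, ← normSq_eq_norm_sq]
      have h2 : normSq (1 - (ε * t : ℂ) * z) - normSq ((t : ℂ) - ε * z) =
          (1 - t ^ 2) * (1 - ε ^ 2 * normSq z) := by
        simp only [normSq_apply, sub_re, sub_im, mul_re, mul_im, ofReal_re, ofReal_im, one_re,
          one_im]
        ring
      have h3 : normSq z ≤ 1 := by
        rw [normSq_eq_norm_sq]; nlinarith [norm_nonneg z]
      rw [hε, one_mul] at h2
      have : 0 ≤ (1 - t ^ 2) * (1 - normSq z) := mul_nonneg (by nlinarith) (by linarith)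
      linarith
    calc ‖ω z‖ = ‖z‖ * (‖(t : ℂ) - ε * z‖ / ‖1 - (ε * t : ℂ) * z‖) := by
          rw [hωdef]; simp only [norm_div, norm_mul]; rw [mul_div_assoc]
      _ ≤ ‖z‖ * 1 := by
          gcongr
          exact div_le_one_of_le₀ h1 (norm_nonneg _)
      _ < 1 := by simpa using hz1
  · rw [c0] at c1; linear_combination c1
  · rw [c0] at c1
    linear_combination c2 + ε * t * c1 + (t ^ 3 - t) * hεc

/-! ### Upper bounds for the logarithmic coefficients -/

/-- Reduction of the estimate of `c₃ + μ c₁ c₂ + ν c₁³` to real variables. -/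
lemma norm_functional_le {μ ν M : ℝ} {ω : ℂ → ℂ} (hω : AnalyticOnNhd ℂ ω unitDisk)
    (hm : MapsTo ω unitDisk unitDisk) (hω0 : ω 0 = 0)
    (hF : ∀ t r w N : ℝ, 0 ≤ t → t ≤ 1 → 0 ≤ r → r ≤ 1 → -r ≤ w →
      N ^ 2 = (1 - t ^ 2) ^ 2 * |μ| ^ 2 * r ^ 2 + (ν * t ^ 2 + (1 - t ^ 2) * r ^ 2) ^ 2 +
        2 * (1 - t ^ 2) * |μ| * (ν * t ^ 2 - (1 - t ^ 2) * r ^ 2) * w -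
        4 * ν * t ^ 2 * (1 - t ^ 2) * w ^ 2 →
      N ≤ |ν| * t ^ 2 + (1 - t ^ 2) * (|μ| * r + r ^ 2) →
      (1 - t ^ 2) * (1 - r ^ 2) + t * N ≤ M) :
    ‖coef ω 3 + μ * coef ω 1 * coef ω 2 + ν * coef ω 1 ^ 3‖ ≤ M := by
  obtain ⟨h1, x, y, hx, hy, h2, h3⟩ := exists_schwarz_parameters hω hm hω0
  rw [h3, h2]
  generalize coef ω 1 = c at *
  set t := ‖c‖ with ht
  have ht0 : 0 ≤ t := norm_nonneg c
  have hs : 0 ≤ 1 - t ^ 2 := by nlinarith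
  obtain ⟨e, he, hc⟩ : ∃ e : ℂ, ‖e‖ = 1 ∧ c = t * e := by
    by_cases h : c = 0
    · exact ⟨1, by simp, by simp [ht, h]⟩
    · have : (‖c‖ : ℂ) ≠ 0 := by simpa using h
      exact ⟨c / ‖c‖, by simp [h], by rw [ht]; field_simp⟩
  have hee : conj e * e = 1 := by rw [conj_mul', he]; simp
  obtain ⟨σ, hσ, hσ2⟩ : ∃ σ : ℝ, |μ| * σ = μ ∧ σ ^ 2 = 1 := by
    rcases abs_cases μ with ⟨h, -⟩ | ⟨h, -⟩
    · exact ⟨1, by rw [h]; ring, by norm_num⟩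
    · exact ⟨-1, by rw [h]; ring, by norm_num⟩
  have hσa : |σ| = 1 := by rw [← abs_one, ← sq_eq_sq_iff_abs_eq_abs, hσ2, one_pow]
  have hσc : ((|μ| : ℝ) : ℂ) * σ = μ := by exact_mod_cast hσ
  have hσ2c : (σ : ℂ) ^ 2 = 1 := by exact_mod_cast hσ2
  -- This rotation factors t e³ out of all terms except the one in y, and σ absorbs the sign of μ.
  set X : ℂ := σ * x * conj e ^ 2 with hX
  have hXn : ‖X‖ = ‖x‖ := by
    rw [hX, norm_mul, norm_mul, norm_pow, RCLike.norm_conj, he, norm_real, Real.norm_eq_abs, hσa]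
    ring
  set Z : ℂ := ((ν * t ^ 2 : ℝ) : ℂ) + ((1 - t ^ 2 : ℝ) : ℂ) * (((|μ| : ℝ) : ℂ) * X - X ^ 2)
    with hZ
  have hsplit : ((1 - t ^ 2 : ℝ) : ℂ) * (y - conj c * x ^ 2) +
      μ * c * (((1 - t ^ 2 : ℝ) : ℂ) * x) + ν * c ^ 3 =
      ((1 - t ^ 2 : ℝ) : ℂ) * y + t * e ^ 3 * Z := by
    have e1 : ((|μ| : ℝ) : ℂ) * X * e ^ 3 = μ * x * e := by
      rw [hX, ← hσc]
      linear_combination (((|μ| : ℝ) : ℂ) * σ * x * e * (conj e * e + 1)) * hee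
    have e2 : X ^ 2 * e ^ 3 = x ^ 2 * conj e := by
      rw [hX]
      linear_combination (x ^ 2 * conj e * (conj e * e) ^ 3) * hσ2c +
        (x ^ 2 * conj e * ((conj e * e) ^ 2 + conj e * e + 1)) * hee
    have e3 : conj c = t * conj e := by rw [hc, map_mul, conj_ofReal]
    rw [e3, hZ, hc]
    push_cast
    linear_combination (t : ℂ) * (1 - t ^ 2) * (e2 - e1)
  rw [hsplit]
  have hN : ‖Z‖ ^ 2 = (1 - t ^ 2) ^ 2 * |μ| ^ 2 * ‖x‖ ^ 2 +
      (ν * t ^ 2 + (1 - t ^ 2) * ‖x‖ ^ 2) ^ 2 +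
      2 * (1 - t ^ 2) * |μ| * (ν * t ^ 2 - (1 - t ^ 2) * ‖x‖ ^ 2) * X.re -
      4 * ν * t ^ 2 * (1 - t ^ 2) * X.re ^ 2 := by
    rw [← hXn, ← normSq_eq_norm_sq Z, ← normSq_eq_norm_sq X, hZ, pow_two X]
    simp only [normSq_apply, add_re, add_im, sub_re, sub_im, mul_re, mul_im, ofReal_re, ofReal_im]
    ring
  have hZle : ‖Z‖ ≤ |ν| * t ^ 2 + (1 - t ^ 2) * (|μ| * ‖x‖ + ‖x‖ ^ 2) := by
    refine (norm_add_le _ _).trans ?_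
    rw [norm_mul, norm_real, norm_real, Real.norm_of_nonneg hs, Real.norm_eq_abs, abs_mul,
      abs_of_nonneg (sq_nonneg t)]
    gcongr
    refine (norm_sub_le _ _).trans ?_
    rw [norm_mul, norm_real, norm_pow, hXn, Real.norm_eq_abs, abs_abs]
  have hre : -‖x‖ ≤ X.re := by
    rw [← hXn]; exact (abs_le.1 (abs_re_le_norm X)).1
  refine le_trans ?_ (hF t ‖x‖ X.re ‖Z‖ ht0 h1 (norm_nonneg x) hx hre hN hZle)
  refine (norm_add_le _ _).trans ?_
  rw [norm_mul, norm_mul, norm_mul, norm_pow, he, norm_real, norm_real, Real.norm_of_nonneg hs,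
    Real.norm_of_nonneg ht0]
  have := mul_le_mul_of_nonneg_left hy hs
  linarith

lemma norm_logCoeff_one_le {A B : ℝ} (hBA : B < A) {f : ℂ → ℂ} (hf : f ∈ classC A B) :
    ‖logCoeff f 1‖ ≤ (A - B) / 4 := by
  obtain ⟨ω, hω, hm, hω0, h1, -, -⟩ := exists_schwarz_of_mem_classC hf
  have h := (exists_schwarz_parameters hω hm hω0).1
  have hc : ((A : ℂ) - B) / 4 = (((A - B) / 4 : ℝ) : ℂ) := by push_cast; ring
  have h0 : 0 ≤ (A - B) / 4 := by linarith
  rw [h1, hc, norm_mul, norm_real, Real.norm_of_nonneg h0]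
  exact mul_le_of_le_one_right h0 h

/-- Since |c₂| ≤ 1 - |c₁|², the functional is bounded by a mean of 1 and |A-5B|/4; M is any common
bound of the two. -/
lemma norm_logCoeff_two_le {A B M : ℝ} (hBA : B < A) (hM1 : 1 ≤ M) (hM : |A - 5 * B| ≤ 4 * M)
    {f : ℂ → ℂ} (hf : f ∈ classC A B) : ‖logCoeff f 2‖ ≤ (A - B) / 12 * M := by
  obtain ⟨ω, hω, hm, hω0, -, h2, -⟩ := exists_schwarz_of_mem_classC hf
  obtain ⟨hc1, x, -, hx, -, hc2, -⟩ := exists_schwarz_parameters hω hm hω0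
  have hc : ((A : ℂ) - B) / 12 = (((A - B) / 12 : ℝ) : ℂ) := by push_cast; ring
  have hc' : ((A : ℂ) - 5 * B) / 4 = (((A - 5 * B) / 4 : ℝ) : ℂ) := by push_cast; ring
  have h0 : 0 ≤ (A - B) / 12 := by linarith
  have hs : 0 ≤ 1 - ‖coef ω 1‖ ^ 2 := by nlinarith [norm_nonneg (coef ω 1)]
  rw [h2, hc, norm_mul, norm_real, Real.norm_of_nonneg h0]
  refine mul_le_mul_of_nonneg_left ?_ h0
  refine (norm_add_le _ _).trans ?_
  rw [hc2, hc', norm_mul, norm_mul, norm_real, norm_real, Real.norm_of_nonneg hs, norm_pow,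
    Real.norm_eq_abs, abs_div, abs_of_pos (by norm_num : (0 : ℝ) < 4)]
  have h1 : (1 - ‖coef ω 1‖ ^ 2) * ‖x‖ ≤ (1 - ‖coef ω 1‖ ^ 2) * M :=
    mul_le_mul_of_nonneg_left (hx.trans hM1) hs
  have h3 : |A - 5 * B| / 4 * ‖coef ω 1‖ ^ 2 ≤ M * ‖coef ω 1‖ ^ 2 :=
    mul_le_mul_of_nonneg_right (by linarith) (sq_nonneg _)
  linarith

/-- Transfer of an estimate in real variables to the third logarithmic coefficient. -/
lemma norm_logCoeff_three_le {A B M : ℝ} (hBA : B < A)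
    (hF : ∀ t r w N : ℝ, 0 ≤ t → t ≤ 1 → 0 ≤ r → r ≤ 1 → -r ≤ w →
      N ^ 2 = (1 - t ^ 2) ^ 2 * |(A - 5 * B) / 2| ^ 2 * r ^ 2 +
        ((3 * B ^ 2 - A * B) / 2 * t ^ 2 + (1 - t ^ 2) * r ^ 2) ^ 2 +
        2 * (1 - t ^ 2) * |(A - 5 * B) / 2| *
          ((3 * B ^ 2 - A * B) / 2 * t ^ 2 - (1 - t ^ 2) * r ^ 2) * w -
        4 * ((3 * B ^ 2 - A * B) / 2) * t ^ 2 * (1 - t ^ 2) * w ^ 2 →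
      N ≤ |(3 * B ^ 2 - A * B) / 2| * t ^ 2 + (1 - t ^ 2) * (|(A - 5 * B) / 2| * r + r ^ 2) →
      (1 - t ^ 2) * (1 - r ^ 2) + t * N ≤ M)
    {f : ℂ → ℂ} (hf : f ∈ classC A B) : ‖logCoeff f 3‖ ≤ (A - B) / 24 * M := by
  obtain ⟨ω, hω, hm, hω0, -, -, h3⟩ := exists_schwarz_of_mem_classC hf
  have h := norm_functional_le hω hm hω0 hF
  have hc : ((A : ℂ) - B) / 24 = (((A - B) / 24 : ℝ) : ℂ) := by push_cast; ring
  have h0 : 0 ≤ (A - B) / 24 := by linarith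
  rw [h3, hc, norm_mul, norm_real, Real.norm_of_nonneg h0]
  push_cast at h
  exact mul_le_mul_of_nonneg_left h h0

/-- As 2ν = B(3B - A), ν ≤ 0 forces B = 0 or 0 < 3B ≤ A ≤ 1. Hence only the crude estimate
`le_one_of_nonpos` is needed for ν ≤ 0. -/
lemma abs_le_half_of_nonpos {A B : ℝ} (hBA : B < A) (hA : A ≤ 1)
    (h : (3 * B ^ 2 - A * B) / 2 ≤ 0) :
    |(A - 5 * B) / 2| ≤ 1 / 2 ∧ -1 ≤ (3 * B ^ 2 - A * B) / 2 := by
  have hB : 0 ≤ B := by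
    by_contra hB
    push Not at hB
    nlinarith [mul_pos_of_neg_of_neg hB (by linarith : B - A < 0), sq_pos_of_neg hB]
  rcases hB.eq_or_lt with rfl | hB
  · norm_num
    exact abs_le.2 ⟨by linarith, by linarith⟩
  · have h1 : 3 * B ≤ A := by
      by_contra h1
      push Not at h1
      nlinarith [mul_pos hB (sub_pos.2 h1)]
    refine ⟨abs_le.2 ⟨by linarith, by linarith⟩, by nlinarith⟩

lemma norm_logCoeff_three_le_of_mem_D1_union_D2 {A B : ℝ} (hBA : B < A) (hA : A ≤ 1)
    (h : paramPoint A B ∈ D1 ∪ D2) {f : ℂ → ℂ} (hf : f ∈ classC A B) :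
    ‖logCoeff f 3‖ ≤ (A - B) / 24 := by
  rw [← mul_one ((A - B) / 24)]
  refine norm_logCoeff_three_le hBA (fun t r w N ht0 ht1 hr0 hr1 hw hN hN' => ?_) hf
  have hpar := abs_le_half_of_nonpos hBA hA
  have hμ0 := abs_nonneg ((A - 5 * B) / 2)
  simp only [D1, D2, paramPoint, mem_union, mem_ofPred_eq] at h
  generalize |(A - 5 * B) / 2| = μ at *
  generalize (3 * B ^ 2 - A * B) / 2 = ν at *
  rcases le_or_gt ν 0 with hν | hν
  · rw [abs_of_nonpos hν] at hN'
    exact le_one_of_nonpos (hpar hν).1 (hpar hν).2 ht0 ht1 hr0 hr1 hN'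
  · have hν1 : ν ≤ 1 := h.elim (fun h => h.2.2) (fun h => h.2.2.2)
    rcases le_total (μ ^ 2) (4 * ν) with hc | hc
    · exact le_of_sq_le_four_mul hν hc le_rfl hν1 ht0 ht1 hN
    · refine le_of_four_mul_le_sq hμ0 hν hc le_rfl ?_ (Or.inl hν1) ht0 ht1 hr0 hr1 hw hN
      rcases h with h | h
      · have h1 : (μ + 1) ^ 2 ≤ (3 / 2) ^ 2 := by
          have := h.1
          gcongr
          linarith
        nlinarith
      · linarith [h.2.2.1]

lemma norm_logCoeff_three_le_of_mem_D6 {A B : ℝ} (hBA : B < A)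
    (h : paramPoint A B ∈ D6) {f : ℂ → ℂ} (hf : f ∈ classC A B) :
    ‖logCoeff f 3‖ ≤ (A - B) / 24 * ((3 * B ^ 2 - A * B) / 2) := by
  refine norm_logCoeff_three_le hBA (fun t r w N ht0 ht1 hr0 hr1 hw hN hN' => ?_) hf
  simp only [D6, paramPoint, mem_ofPred_eq] at h
  refine le_of_sq_add_eight_le ?_ ?_ ht0 ht1 hr0 hr1 hN
  · nlinarith [h.1]
  · rw [sq_abs]; linarith [h.2.2]

/-- The bound on `D8 ∪ D9`, through its defining properties. -/
lemma norm_logCoeff_three_le_of_mem_D8_union_D9 {A B M : ℝ} (hBA : B < A) (hA : A ≤ 1)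
    (h : paramPoint A B ∈ D8 ∪ D9) (hM0 : 0 ≤ M)
    (hM : 27 * M ^ 2 * (|(A - 5 * B) / 2| + 1 + (3 * B ^ 2 - A * B) / 2) =
      4 * (|(A - 5 * B) / 2| + 1) ^ 3)
    {f : ℂ → ℂ} (hf : f ∈ classC A B) : ‖logCoeff f 3‖ ≤ (A - B) / 24 * M := by
  refine norm_logCoeff_three_le hBA (fun t r w N ht0 ht1 hr0 hr1 hw hN hN' => ?_) hf
  have hpar := abs_le_half_of_nonpos hBA hA
  have hμ0 := abs_nonneg ((A - 5 * B) / 2)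
  simp only [D8, D9, paramPoint, mem_union, mem_ofPred_eq] at h
  rw [← sq_abs ((A - 5 * B) / 2)] at h
  generalize |(A - 5 * B) / 2| = μ at *
  generalize (3 * B ^ 2 - A * B) / 2 = ν at *
  have hone : 4 * (μ + 1) ^ 3 ≥ 27 * (μ + 1 + ν) → 0 < μ + 1 + ν → 1 ≤ M := by
    intro h1 h2
    refine le_of_sq_le_sq_of_nonneg ?_ hM0
    have : 27 * (μ + 1 + ν) * 1 ^ 2 ≤ 27 * (μ + 1 + ν) * M ^ 2 := by linarith
    exact le_of_mul_le_mul_left this (by linarith)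
  rcases le_or_gt ν 0 with hν | hν
  · obtain ⟨h1, h2⟩ := hpar hν
    rw [abs_of_nonpos hν] at hN'
    have h3 : (1 - t ^ 2) * (1 - r ^ 2) + t * N ≤ 1 :=
      le_one_of_nonpos h1 h2 ht0 ht1 hr0 hr1 hN'
    refine h3.trans (hone ?_ ?_)
    · rcases h with h | h
      · linarith [h.2.2.2]
      · linarith [h.1]
    · rcases h with h | h
      · linarith [h.2.2.1]
      · linarith [h.1]
  · rcases h with ⟨h1, h2, -, h4⟩ | ⟨h1, -, h3⟩
    · have hν1 : ν ≤ 1 := by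
        have : (μ + 1) * (4 / 27 * (μ + 1) ^ 2 - 1) ≤ 3 * (1 / 3) := by
          have h5 : (μ + 1) ^ 2 ≤ 3 ^ 2 := by gcongr; linarith
          nlinarith
        nlinarith
      have hc : 4 * ν ≤ μ ^ 2 := by
        -- This product is μ² minus four times the upper bound for ν in `D8`.
        have : 0 ≤ (2 - μ) * (16 / 27 * (μ + 1) ^ 2 + 7 / 9 * (μ + 1) + 1 / 3) :=
          mul_nonneg (by linarith) (by positivity)
        nlinarith
      exact le_of_four_mul_le_sq hμ0 hν hc (hone (by linarith) (by linarith)) hM.ge (Or.inl hν1)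
        ht0 ht1 hr0 hr1 hw hN
    · have hq : 0 < μ ^ 2 + 2 * μ + 4 := by positivity
      rw [le_div_iff₀ hq] at h3
      have hc : 4 * ν ≤ μ ^ 2 := by
        have h5 : 0 ≤ μ * ((μ - 2) * (μ + 2) ^ 2) :=
          mul_nonneg hμ0 (mul_nonneg (by linarith) (sq_nonneg _))
        have h6 : 4 * ν * (μ ^ 2 + 2 * μ + 4) ≤ μ ^ 2 * (μ ^ 2 + 2 * μ + 4) := by linarith
        exact le_of_mul_le_mul_right h6 hq
      have hk : 3 * ν ≤ μ + 1 := by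
        have h5 : 0 ≤ (μ + 1) * (μ - 2) ^ 2 := by positivity
        have h6 : 3 * ν * (μ ^ 2 + 2 * μ + 4) ≤ (μ + 1) * (μ ^ 2 + 2 * μ + 4) := by linarith
        exact le_of_mul_le_mul_right h6 hq
      have h1M : 1 ≤ M := by
        refine hone ?_ (by linarith)
        have : 3 ^ 2 ≤ (μ + 1) ^ 2 := by gcongr; linarith
        nlinarith
      exact le_of_four_mul_le_sq hμ0 hν hc h1M hM.ge (Or.inr h3) ht0 ht1 hr0 hr1 hw hN

/-! ### The extremal value on D8 ∪ D9 -/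

/-- The lower bound on ν in `D8` and `D9` is what places the maximizer of the cubic in [0, 1]. -/
lemma pos_of_mem_D8_union_D9 {A B : ℝ} (h : paramPoint A B ∈ D8 ∪ D9) :
    |(A - 5 * B) / 2| + 1 ≤ 3 * (|(A - 5 * B) / 2| + 1 + (3 * B ^ 2 - A * B) / 2) := by
  simp only [D8, D9, paramPoint, mem_union, mem_ofPred_eq] at h
  rcases h with h | h
  · linarith [h.2.2.1]
  · linarith [h.2.1]

/-- The extremal function on `D8 ∪ D9`. -/
lemma exists_norm_logCoeff_three_eq {A B t : ℝ} (hBA : B < A) (hB : |B| ≤ 1) (ht0 : 0 ≤ t)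
    (ht1 : t ≤ 1)
    (ht : 3 * (|(A - 5 * B) / 2| + 1 + (3 * B ^ 2 - A * B) / 2) * t ^ 2 =
      |(A - 5 * B) / 2| + 1) :
    ∃ f ∈ classC A B,
      ‖logCoeff f 3‖ = (A - B) / 24 * (2 / 3 * (|(A - 5 * B) / 2| + 1) * t) := by
  obtain ⟨ε, hε, hε2⟩ : ∃ ε : ℝ, ε * ((A - 5 * B) / 2) = |(A - 5 * B) / 2| ∧ ε ^ 2 = 1 := by
    rcases abs_cases ((A - 5 * B) / 2) with ⟨h, -⟩ | ⟨h, -⟩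
    · exact ⟨1, by rw [h]; ring, by norm_num⟩
    · exact ⟨-1, by rw [h]; ring, by norm_num⟩
  obtain ⟨ω, hω, hm, hω0, c1, c2, c3⟩ := exists_moebius_schwarz ht0 ht1 hε2
  obtain ⟨f, hf, -, -, h3⟩ := exists_mem_classC_logCoeff A hB hω hm hω0
  refine ⟨f, hf, ?_⟩
  have h0 : 0 ≤ (A - B) / 24 * (2 / 3 * (|(A - 5 * B) / 2| + 1) * t) :=
    mul_nonneg (by linarith) (by positivity)
  -- The functional equals minus the cubic at t; at its critical point the cubic has the value
  -- (2/3)(|μ|+1)t.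
  have hreal : (A - B) / 24 * (-(t * (1 - t ^ 2)) +
      (A - 5 * B) / 2 * t * -(ε * (1 - t ^ 2)) + (3 * B ^ 2 - A * B) / 2 * t ^ 3) =
      -((A - B) / 24 * (2 / 3 * (|(A - 5 * B) / 2| + 1) * t)) := by
    linear_combination (A - B) / 24 * (-(t * (1 - t ^ 2)) * hε + t / 3 * ht)
  have : logCoeff f 3 =
      ((-((A - B) / 24 * (2 / 3 * (|(A - 5 * B) / 2| + 1) * t)) : ℝ) : ℂ) := by
    rw [h3, c1, c2, c3, ← hreal]
    push_cast
    ring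
  rw [this, norm_real, norm_neg, Real.norm_of_nonneg h0]

lemma bound_eq {A B : ℝ} (hp : 0 < |(A - 5 * B) / 2| + 1 + (3 * B ^ 2 - A * B) / 2) :
    (A - B) / (72 * Real.sqrt 3) * ((|A - 5 * B| + 2) ^ (3 / 2 : ℝ) /
      Real.sqrt (|A - 5 * B| + 2 + 3 * B ^ 2 - A * B)) =
    (A - B) / 24 * (2 / 3 * (|(A - 5 * B) / 2| + 1) * Real.sqrt ((|(A - 5 * B) / 2| + 1) /
      (3 * (|(A - 5 * B) / 2| + 1 + (3 * B ^ 2 - A * B) / 2)))) := by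
  have habs : |(A - 5 * B) / 2| = |A - 5 * B| / 2 := by
    rw [abs_div, abs_of_pos (by norm_num : (0 : ℝ) < 2)]
  rw [habs] at hp ⊢
  have hP : 0 < |A - 5 * B| + 2 := by positivity
  have hS : 0 < |A - 5 * B| + 2 + 3 * B ^ 2 - A * B := by linarith
  have e1 : (|A - 5 * B| / 2 + 1) / (3 * (|A - 5 * B| / 2 + 1 + (3 * B ^ 2 - A * B) / 2)) =
      (|A - 5 * B| + 2) / (3 * (|A - 5 * B| + 2 + 3 * B ^ 2 - A * B)) := by
    rw [div_eq_div_iff (by linarith) (by linarith)]; ring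
  have e2 : (|A - 5 * B| + 2) ^ (3 / 2 : ℝ) = (|A - 5 * B| + 2) * Real.sqrt (|A - 5 * B| + 2) := by
    rw [Real.sqrt_eq_rpow, show (3 / 2 : ℝ) = 1 + 1 / 2 by norm_num, Real.rpow_add hP,
      Real.rpow_one]
  rw [e1, e2, Real.sqrt_div hP.le, Real.sqrt_mul (by norm_num : (0 : ℝ) ≤ 3)]
  have h1 := Real.sqrt_pos.2 hS
  have h3 : 0 < Real.sqrt 3 := Real.sqrt_pos.2 (by norm_num)
  generalize Real.sqrt (|A - 5 * B| + 2 + 3 * B ^ 2 - A * B) = S at *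
  field_simp
  ring

end JanowskiConvex

open JanowskiConvex

/-- Sharp bounds (`IsGreatest`: an upper bound that is attained) for the first three logarithmic
coefficients in `C(A, B)`, and the failure of the bounds `|γ₂| ≤ 5|B|²/48`, `|γ₃| ≤ |B|³/16`
in `C(0, B)`, `-0.99 ≤ B < 0`. -/
theorem mainTheorem2 :
    (∀ A B : ℝ, -1 ≤ B → B < A → A ≤ 1 →
      IsGreatest (JanowskiConvex.logCoeffValues A B 1) ((A - B) / 4) ∧
      (|A - 5 * B| ≤ 4 →
        IsGreatest (JanowskiConvex.logCoeffValues A B 2) ((A - B) / 12)) ∧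
      (4 < |A - 5 * B| →
        IsGreatest (JanowskiConvex.logCoeffValues A B 2) ((A - B) / 48 * |A - 5 * B|)) ∧
      (JanowskiConvex.paramPoint A B ∈ JanowskiConvex.D1 ∪ JanowskiConvex.D2 →
        IsGreatest (JanowskiConvex.logCoeffValues A B 3) ((A - B) / 24)) ∧
      (JanowskiConvex.paramPoint A B ∈ JanowskiConvex.D6 →
        IsGreatest (JanowskiConvex.logCoeffValues A B 3)
          ((A - B) / 48 * |B * (A - 3 * B)|)) ∧
      (JanowskiConvex.paramPoint A B ∈ JanowskiConvex.D8 ∪ JanowskiConvex.D9 →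
        IsGreatest (JanowskiConvex.logCoeffValues A B 3)
          ((A - B) / (72 * Real.sqrt 3) *
            ((|A - 5 * B| + 2) ^ (3 / 2 : ℝ) /
              Real.sqrt (|A - 5 * B| + 2 + 3 * B ^ 2 - A * B))))) ∧
    (∃ B : ℝ, -(99 / 100) ≤ B ∧ B < 0 ∧ ∃ f ∈ JanowskiConvex.classC 0 B,
      5 * |B| ^ 2 / 48 < ‖JanowskiConvex.logCoeff f 2‖) ∧
    (∃ B : ℝ, -(99 / 100) ≤ B ∧ B < 0 ∧ ∃ f ∈ JanowskiConvex.classC 0 B,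
      |B| ^ 3 / 16 < ‖JanowskiConvex.logCoeff f 3‖) := by
  refine ⟨fun A B hB hBA hA => ?_, ?_, ?_⟩
  · have hB1 : |B| ≤ 1 := abs_le.2 ⟨hB, by linarith⟩
    have hsub : 0 ≤ A - B := by linarith
    obtain ⟨f₁, hf₁, h11, h12, h13⟩ := exists_mem_classC_pow A hB1 one_ne_zero
    obtain ⟨f₂, hf₂, -, h22, -⟩ := exists_mem_classC_pow A hB1 two_ne_zero
    obtain ⟨f₃, hf₃, -, -, h33⟩ := exists_mem_classC_pow A hB1 three_ne_zero
    norm_num at h11 h12 h13 h22 h33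
    refine ⟨⟨⟨f₁, hf₁, ?_⟩, ?_⟩, fun h => ⟨⟨f₂, hf₂, ?_⟩, ?_⟩, fun h => ⟨⟨f₁, hf₁, ?_⟩, ?_⟩,
      fun h => ⟨⟨f₃, hf₃, ?_⟩, ?_⟩, fun h => ⟨⟨f₁, hf₁, ?_⟩, ?_⟩, fun h => ?_⟩
    · rw [h11, show ((A : ℂ) - B) / 4 = (((A - B) / 4 : ℝ) : ℂ) by push_cast; ring,
        Complex.norm_real, Real.norm_of_nonneg (by linarith)]
    · rintro _ ⟨f, hf, rfl⟩
      exact norm_logCoeff_one_le hBA hf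
    · rw [h22, show ((A : ℂ) - B) / 12 = (((A - B) / 12 : ℝ) : ℂ) by push_cast; ring,
        Complex.norm_real, Real.norm_of_nonneg (by linarith)]
    · rintro _ ⟨f, hf, rfl⟩
      simpa using norm_logCoeff_two_le hBA le_rfl (by linarith) hf
    · rw [h12, show ((A : ℂ) - B) / 12 * ((A - 5 * B) / 4) =
          (((A - B) / 48 * (A - 5 * B) : ℝ) : ℂ) by push_cast; ring,
        Complex.norm_real, Real.norm_eq_abs, abs_mul,
        abs_of_nonneg (by linarith : 0 ≤ (A - B) / 48)]
    · rintro _ ⟨f, hf, rfl⟩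
      have := norm_logCoeff_two_le (M := |A - 5 * B| / 4) hBA (by linarith) (by linarith) hf
      linarith
    · rw [h33, show ((A : ℂ) - B) / 24 = (((A - B) / 24 : ℝ) : ℂ) by push_cast; ring,
        Complex.norm_real, Real.norm_of_nonneg (by linarith)]
    · rintro _ ⟨f, hf, rfl⟩
      exact norm_logCoeff_three_le_of_mem_D1_union_D2 hBA hA h hf
    · rw [h13, show ((A : ℂ) - B) / 24 * ((3 * B ^ 2 - A * B) / 2) =
          (-((A - B) / 48 * (B * (A - 3 * B))) : ℝ) by push_cast; ring,
        Complex.norm_real, norm_neg, Real.norm_eq_abs, abs_mul ((A - B) / 48),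
        abs_of_nonneg (by linarith : 0 ≤ (A - B) / 48)]
    · rintro _ ⟨f, hf, rfl⟩
      refine (norm_logCoeff_three_le_of_mem_D6 hBA h hf).trans ?_
      have h1 : 3 * B ^ 2 - A * B ≤ |B * (A - 3 * B)| := by
        refine le_trans (le_of_eq ?_) (neg_le_abs _)
        ring
      have := mul_le_mul_of_nonneg_left h1 (by linarith : 0 ≤ (A - B) / 48)
      linarith
    · have hp := pos_of_mem_D8_union_D9 h
      have hp0 : 0 < |(A - 5 * B) / 2| + 1 := by positivity
      have hq0 : 0 < |(A - 5 * B) / 2| + 1 + (3 * B ^ 2 - A * B) / 2 := by linarith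
      rw [bound_eq hq0]
      have ht0 := Real.sqrt_nonneg ((|(A - 5 * B) / 2| + 1) /
        (3 * (|(A - 5 * B) / 2| + 1 + (3 * B ^ 2 - A * B) / 2)))
      have ht2 := Real.sq_sqrt (div_nonneg hp0.le (by linarith) :
        0 ≤ (|(A - 5 * B) / 2| + 1) /
          (3 * (|(A - 5 * B) / 2| + 1 + (3 * B ^ 2 - A * B) / 2)))
      have ht1 : Real.sqrt ((|(A - 5 * B) / 2| + 1) /
          (3 * (|(A - 5 * B) / 2| + 1 + (3 * B ^ 2 - A * B) / 2))) ≤ 1 :=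
        Real.sqrt_le_one.2 (div_le_one_of_le₀ hp (by linarith))
      rw [eq_div_iff (by linarith)] at ht2
      generalize Real.sqrt ((|(A - 5 * B) / 2| + 1) /
        (3 * (|(A - 5 * B) / 2| + 1 + (3 * B ^ 2 - A * B) / 2))) = t at *
      constructor
      · obtain ⟨f, hf, hf3⟩ := exists_norm_logCoeff_three_eq hBA hB1 ht0 ht1 (by linarith)
        exact ⟨f, hf, hf3.symm⟩
      · rintro _ ⟨f, hf, rfl⟩
        refine norm_logCoeff_three_le_of_mem_D8_union_D9 hBA hA h (by positivity) ?_ hf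
        linear_combination 4 * (|(A - 5 * B) / 2| + 1) ^ 2 * ht2
  -- For ω = z² and A = 0 the value is |B|/12, linear in |B|, so it exceeds 5|B|²/48 at B = -1/2.
  -- Likewise ω = z³ gives |B|/24 against |B|³/16.
  · obtain ⟨f, hf, -, h2, -⟩ := exists_mem_classC_pow 0 (B := -(1 / 2))
      (by rw [abs_neg, abs_of_pos] <;> norm_num) two_ne_zero
    refine ⟨-(1 / 2), by norm_num, by norm_num, f, hf, ?_⟩
    norm_num at h2
    rw [h2, abs_neg, abs_of_pos (by norm_num : (0 : ℝ) < 1 / 2)]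
    norm_num
  · obtain ⟨f, hf, -, -, h3⟩ := exists_mem_classC_pow 0 (B := -(1 / 2))
      (by rw [abs_neg, abs_of_pos] <;> norm_num) three_ne_zero
    refine ⟨-(1 / 2), by norm_num, by norm_num, f, hf, ?_⟩
    norm_num at h3
    rw [h3, abs_neg, abs_of_pos (by norm_num : (0 : ℝ) < 1 / 2)]
    norm_num
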